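/- Let $\mathbb{D}$ be the open unit disk and let $H^2$ be the Hardy space of analytic functions $f$ on $\mathbb{D}$ with $\|f\|^2=\sup_{0<r<1}\frac1{2\pi}\int_0^{2\pi}|f(re^{it})|^2\,dt<\infty$. For an analytic map $\varphi\colon\mathbb{D}\to\mathbb{D}$ and $w\in H^2$, let $M_wC_\varphi$ denote the weighted composition operator $f\mapsto w\,(f\circ\varphi)$ on $H^2$. For $p>0$, a compact operator $T$ on $H^2$ belongs to the Schatten class $S_p$ if its singular numbers $s_n(T)$ (the eigenvalues of $|T|=\sqrt{T^*T}$, counted with multiplicity) satisfy $\sum_n s_n(T)^p<\infty$; $S_2$ is the class of Hilbert–Schmidt operators. **Theorem.** Let $\varphi\colon\mathbb{D}\to\mathbb{D}$ be analytic, and suppose that $M_{w_0}C_\varphi$ is a Hilbert–Schmidt operator on $H^2$ for some $w_0\in H^2$, $w_0\not\equiv0$. Then there exists another weight $w\in H^2$, $w\not\equiv0$, $w\ne w_0$, such that $M_wC_\varphi$ is a bounded operator on $H^2$ which belongs to $S_p$ for every $p$ with $0<p<2$. -/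

import Mathlib

open Metric Set Filter Topology

noncomputable section

/-! ### Taylor coefficients and Parseval's identity on the unit disk -/

/-- The `n`-th Taylor coefficient of `f` at the origin. -/
def taylorCoeff (f : ℂ → ℂ) (n : ℕ) : ℂ := (n.factorial : ℂ)⁻¹ * iteratedDeriv n f 0

theorem hasSum_taylorCoeff {f : ℂ → ℂ} (hf : DifferentiableOn ℂ f (ball 0 1)) {z : ℂ}
    (hz : z ∈ ball (0 : ℂ) 1) : HasSum (fun n => taylorCoeff f n * z ^ n) (f z) := by
  have h := Complex.hasSum_taylorSeries_on_ball hf hz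
  have he : (fun n : ℕ => ((n.factorial : ℂ))⁻¹ • (z - 0) ^ n • iteratedDeriv n f 0) =
      fun n => taylorCoeff f n * z ^ n := by
    funext n
    simp only [taylorCoeff, smul_eq_mul, sub_zero]
    ring
  rwa [he] at h

theorem contDiffAt_zero_of_disk {f : ℂ → ℂ} (hf : DifferentiableOn ℂ f (ball 0 1)) (n : ℕ) :
    ContDiffAt ℂ n f 0 :=
  ((hf.analyticOnNhd isOpen_ball) 0 (by simp)).contDiffAt

theorem taylorCoeff_add {f g : ℂ → ℂ} (hf : DifferentiableOn ℂ f (ball 0 1))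
    (hg : DifferentiableOn ℂ g (ball 0 1)) (n : ℕ) :
    taylorCoeff (f + g) n = taylorCoeff f n + taylorCoeff g n := by
  unfold taylorCoeff
  rw [iteratedDeriv_add (contDiffAt_zero_of_disk hf n) (contDiffAt_zero_of_disk hg n), mul_add]

theorem taylorCoeff_smul {f : ℂ → ℂ} (hf : DifferentiableOn ℂ f (ball 0 1)) (c : ℂ) (n : ℕ) :
    taylorCoeff (c • f) n = c * taylorCoeff f n := by
  unfold taylorCoeff
  rw [iteratedDeriv_const_smul (contDiffAt_zero_of_disk hf n)]
  simp only [smul_eq_mul]; ring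

/-- The mean of `|f|²` on the circle of radius `r`: `(1 / 2π) ∫₀^{2π} |f (r e^{it})|² dt`. -/
def hardyMean (f : ℂ → ℂ) (r : ℝ) : ℝ :=
  (2 * Real.pi)⁻¹ * ∫ t in (0 : ℝ)..2 * Real.pi, ‖f (r * Complex.exp (t * Complex.I))‖ ^ 2

theorem hardyMean_eq_circleAverage (f : ℂ → ℂ) (r : ℝ) :
    hardyMean f r = Real.circleAverage (fun z => ‖f z‖ ^ 2) 0 r := by
  simp [hardyMean, Real.circleAverage_def, circleMap]

theorem summable_norm_taylorCoeff {f : ℂ → ℂ} (hf : DifferentiableOn ℂ f (ball 0 1)) {r : ℝ}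
    (hr : r ∈ Ico (0 : ℝ) 1) : Summable fun n => ‖taylorCoeff f n‖ * r ^ n := by
  have h := (hasSum_taylorCoeff hf (z := (r : ℂ))
    (by simpa [abs_of_nonneg hr.1] using hr.2)).summable.norm
  simpa [abs_of_nonneg hr.1] using h

theorem hasSum_hardyMean {f : ℂ → ℂ} (hf : DifferentiableOn ℂ f (ball 0 1)) {r : ℝ}
    (hr : r ∈ Ioo (0 : ℝ) 1) :
    HasSum (fun n => ‖taylorCoeff f n‖ ^ 2 * r ^ (2 * n)) (hardyMean f r) := by
  rw [hasSum_iff_tendsto_nat_of_nonneg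
    (fun n => mul_nonneg (sq_nonneg _) (pow_nonneg hr.1.le _))]
  have hS := summable_norm_taylorCoeff hf ⟨hr.1.le, hr.2⟩
  have key : ∀ N : ℕ, ∑ n ∈ Finset.range N, ‖taylorCoeff f n‖ ^ 2 * r ^ (2 * n) =
      Real.circleAverage
        (fun z => ‖∑ n ∈ Finset.range N, taylorCoeff f n * (r * z) ^ n‖ ^ 2) 0 1 := by
    intro N
    have h := Polynomial.sum_sq_norm_coeff_eq_circleAverage
      (∑ n ∈ Finset.range N, Polynomial.monomial n (taylorCoeff f n * (r : ℂ) ^ n))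
    have hc : ∀ m, (∑ n ∈ Finset.range N,
        Polynomial.monomial n (taylorCoeff f n * (r : ℂ) ^ n)).coeff m =
        if m < N then taylorCoeff f m * (r : ℂ) ^ m else 0 := by
      intro m
      simp [Polynomial.coeff_monomial]
    rw [Finset.sum_subset (s₂ := Finset.range N)] at h
    · simp only [Polynomial.eval_finsetSum, Polynomial.eval_monomial] at h
      simp only [mul_pow, ← mul_assoc]
      rw [← h]
      refine Finset.sum_congr rfl fun n hn => ?_
      rw [hc, if_pos (Finset.mem_range.mp hn)]
      simp only [norm_mul, norm_pow, Complex.norm_real, Real.norm_eq_abs, abs_of_pos hr.1]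
      ring
    · intro m hm
      by_contra hmN
      rw [Finset.mem_range] at hmN
      simp [hc, hmN] at hm
    · intro m _ hm
      rw [Polynomial.notMem_support_iff] at hm
      simp [hm]
  simp only [key]
  rw [hardyMean_eq_circleAverage, Real.circleAverage_eq_circleAverage_zero_one]
  simp only [Real.circleAverage_def]
  refine Tendsto.const_smul ?_ _
  have hnorm : ∀ t : ℝ, ‖(r : ℂ) * circleMap 0 1 t‖ = r := by
    intro t; simp [abs_of_pos hr.1]
  refine intervalIntegral.tendsto_integral_filter_of_dominated_convergence
    (fun _ => (∑' n, ‖taylorCoeff f n‖ * r ^ n) ^ 2) ?_ ?_ ?_ ?_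
  · refine Eventually.of_forall fun N => Continuous.aestronglyMeasurable ?_
    fun_prop
  · refine Eventually.of_forall fun N => Eventually.of_forall fun t _ => ?_
    rw [Real.norm_eq_abs, abs_of_nonneg (sq_nonneg _)]
    refine pow_le_pow_left₀ (norm_nonneg _) ?_ 2
    refine (norm_sum_le _ _).trans ?_
    have : ∀ n, ‖taylorCoeff f n * ((r : ℂ) * circleMap 0 1 t) ^ n‖ =
        ‖taylorCoeff f n‖ * r ^ n := by
      intro n; rw [norm_mul, norm_pow, hnorm]
    simp only [this]
    exact hS.sum_le_tsum _ (fun n _ => mul_nonneg (norm_nonneg _) (pow_nonneg hr.1.le _))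
  · exact intervalIntegrable_const
  · refine Eventually.of_forall fun t _ => ?_
    have h := (hasSum_taylorCoeff hf (z := (r : ℂ) * circleMap 0 1 t)
      (by rw [mem_ball_zero_iff, hnorm]; exact hr.2)).tendsto_sum_nat
    simpa using (h.norm.pow 2)

theorem summable_of_bddAbove_hardyMean {f : ℂ → ℂ} (hf : DifferentiableOn ℂ f (ball 0 1))
    {C : ℝ} (hC : C ∈ upperBounds (hardyMean f '' Ioo 0 1)) :
    Summable (fun n => ‖taylorCoeff f n‖ ^ 2) ∧ ∑' n, ‖taylorCoeff f n‖ ^ 2 ≤ C := by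
  have hle : ∀ N, ∑ n ∈ Finset.range N, ‖taylorCoeff f n‖ ^ 2 ≤ C := by
    intro N
    have hlim : Tendsto
        (fun r : ℝ => ∑ n ∈ Finset.range N, ‖taylorCoeff f n‖ ^ 2 * r ^ (2 * n)) (𝓝[<] 1)
        (𝓝 (∑ n ∈ Finset.range N, ‖taylorCoeff f n‖ ^ 2 * (1 : ℝ) ^ (2 * n))) := by
      refine Tendsto.mono_left (Continuous.tendsto ?_ _) nhdsWithin_le_nhds
      fun_prop
    simp only [one_pow, mul_one] at hlim
    refine le_of_tendsto hlim ?_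
    filter_upwards [Ioo_mem_nhdsLT (zero_lt_one' ℝ)] with r hr
    exact (sum_le_hasSum _ (fun n _ => mul_nonneg (sq_nonneg _) (pow_nonneg hr.1.le _))
      (hasSum_hardyMean hf hr)).trans (hC (mem_image_of_mem _ hr))
  exact ⟨summable_of_sum_range_le (fun n => sq_nonneg _) hle,
    Real.tsum_le_of_sum_range_le (fun n => sq_nonneg _) hle⟩

theorem hardyMean_le_tsum {f : ℂ → ℂ} (hf : DifferentiableOn ℂ f (ball 0 1))
    (hs : Summable (fun n => ‖taylorCoeff f n‖ ^ 2)) :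
    ∑' n, ‖taylorCoeff f n‖ ^ 2 ∈ upperBounds (hardyMean f '' Ioo 0 1) := by
  rintro _ ⟨r, hr, rfl⟩
  refine hasSum_le (fun n => ?_) (hasSum_hardyMean hf hr) hs.hasSum
  exact mul_le_of_le_one_right (sq_nonneg _) (pow_le_one₀ hr.1.le hr.2.le)

theorem bddAbove_hardyMean_iff {f : ℂ → ℂ} (hf : DifferentiableOn ℂ f (ball 0 1)) :
    BddAbove (hardyMean f '' Ioo 0 1) ↔ Summable (fun n => ‖taylorCoeff f n‖ ^ 2) :=
  ⟨fun ⟨_, hC⟩ => (summable_of_bddAbove_hardyMean hf hC).1,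
    fun hs => ⟨_, hardyMean_le_tsum hf hs⟩⟩

/-! ### The Hardy space `H²` -/

theorem memℓp_two_iff_summable {c : ℕ → ℂ} : Memℓp c 2 ↔ Summable fun n => ‖c n‖ ^ 2 := by
  rw [memℓp_gen_iff (by norm_num)]
  norm_num

/-- The Hardy space of the unit disk as a vector space of functions: analytic functions on the
open unit disk whose quadratic means over the circles `|z| = r`, `0 < r < 1`, are bounded. An
analytic function on the disk is represented by its extension by `0` to `ℂ`, so that two elements
are equal if and only if they agree on the disk. -/
def hardySubmodule : Submodule ℂ (ℂ → ℂ) where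
  carrier := {f | DifferentiableOn ℂ f (ball 0 1) ∧ (∀ z ∉ ball (0 : ℂ) 1, f z = 0) ∧
    BddAbove (hardyMean f '' Ioo 0 1)}
  add_mem' := by
    rintro f g ⟨hf, hf0, hfb⟩ ⟨hg, hg0, hgb⟩
    refine ⟨hf.add hg, fun z hz => by simp [hf0 z hz, hg0 z hz], ?_⟩
    rw [bddAbove_hardyMean_iff hf, ← memℓp_two_iff_summable] at hfb
    rw [bddAbove_hardyMean_iff hg, ← memℓp_two_iff_summable] at hgb
    rw [bddAbove_hardyMean_iff (hf.add hg), ← memℓp_two_iff_summable]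
    convert hfb.add hgb using 1
    exact funext fun n => taylorCoeff_add hf hg n
  zero_mem' := ⟨differentiableOn_const 0, fun _ _ => rfl, ⟨0, by
    rintro _ ⟨r, _, rfl⟩
    simp [hardyMean]⟩⟩
  smul_mem' := by
    rintro c f ⟨hf, hf0, hfb⟩
    refine ⟨hf.const_smul c, fun z hz => by simp [hf0 z hz], ?_⟩
    rw [bddAbove_hardyMean_iff hf, ← memℓp_two_iff_summable] at hfb
    rw [bddAbove_hardyMean_iff (hf.const_smul c), ← memℓp_two_iff_summable]
    convert hfb.const_smul c using 1
    exact funext fun n => taylorCoeff_smul hf c n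

/-- The Hardy space `H²` of the unit disk. -/
def HardySpace : Type := hardySubmodule

namespace HardySpace

instance : AddCommGroup HardySpace := inferInstanceAs (AddCommGroup hardySubmodule)

instance : Module ℂ HardySpace := inferInstanceAs (Module ℂ hardySubmodule)

/-- An element of `H²` as a function (extended by `0` off the open unit disk). -/
instance : CoeFun HardySpace (fun _ => ℂ → ℂ) := ⟨fun f => f.1⟩

theorem differentiableOn (f : HardySpace) : DifferentiableOn ℂ f (ball 0 1) := f.2.1

theorem eq_zero_of_notMem (f : HardySpace) {z : ℂ} (hz : z ∉ ball (0 : ℂ) 1) : f z = 0 :=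
  f.2.2.1 z hz

theorem bddAbove_hardyMean (f : HardySpace) : BddAbove (hardyMean f '' Ioo 0 1) := f.2.2.2

theorem add_apply (f g : HardySpace) (z : ℂ) : (f + g) z = f z + g z := rfl

theorem smul_apply (c : ℂ) (f : HardySpace) (z : ℂ) : (c • f) z = c * f z := rfl

theorem ext_disk {f g : HardySpace} (h : ∀ z ∈ ball (0 : ℂ) 1, f z = g z) : f = g := by
  refine Subtype.ext (funext fun z => ?_)
  by_cases hz : z ∈ ball (0 : ℂ) 1
  · exact h z hz
  · exact (f.eq_zero_of_notMem hz).trans (g.eq_zero_of_notMem hz).symm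

/-- The map sending an element of `H²` to its sequence of Taylor coefficients. -/
def coeffMap : HardySpace →ₗ[ℂ] lp (fun _ : ℕ => ℂ) 2 where
  toFun f := ⟨taylorCoeff f,
    memℓp_two_iff_summable.2 ((bddAbove_hardyMean_iff f.differentiableOn).1 f.bddAbove_hardyMean)⟩
  map_add' f g := by
    refine Subtype.ext (funext fun n => ?_)
    exact taylorCoeff_add f.differentiableOn g.differentiableOn n
  map_smul' c f := by
    refine Subtype.ext (funext fun n => ?_)
    exact taylorCoeff_smul f.differentiableOn c n

theorem coeffMap_apply (f : HardySpace) (n : ℕ) : coeffMap f n = taylorCoeff f n := rfl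

theorem coeffMap_injective : Function.Injective coeffMap := by
  intro f g h
  refine ext_disk fun z hz => ?_
  have hf := hasSum_taylorCoeff f.differentiableOn hz
  have hg := hasSum_taylorCoeff g.differentiableOn hz
  simp only [← coeffMap_apply, h] at hf hg
  exact hf.unique hg

theorem coeffMap_surjective : Function.Surjective coeffMap := by
  intro c
  have hc : Memℓp (fun n => c n) 2 := c.2
  set p : FormalMultilinearSeries ℂ ℂ ℂ := FormalMultilinearSeries.ofScalars ℂ (fun n => c n)
    with hp
  have hrad : 1 ≤ p.radius := by
    refine p.le_radius_of_bound ‖c‖ (r := 1) fun n => ?_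
    rw [hp, FormalMultilinearSeries.ofScalars_norm]
    simpa using lp.norm_apply_le_norm (by norm_num) c n
  have hps := (p.hasFPowerSeriesOnBall (zero_lt_one.trans_le hrad)).mono zero_lt_one hrad
  set f : ℂ → ℂ := (ball (0 : ℂ) 1).indicator p.sum with hfdef
  have hball : eball (0 : ℂ) 1 = ball 0 1 := by
    simpa using Metric.eball_ofReal (x := (0 : ℂ)) (ε := 1)
  have hfs : HasFPowerSeriesOnBall f p 0 1 := by
    refine hps.congr fun z hz => ?_
    rw [hball] at hz
    rw [hfdef, indicator_of_mem hz]
  have hfd : DifferentiableOn ℂ f (ball 0 1) := by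
    rw [← hball]; exact hfs.differentiableOn
  have hcoeff : ∀ n, taylorCoeff f n = c n := by
    intro n
    have h := hfs.factorial_smul (1 : ℂ) n
    rw [← iteratedDeriv_eq_iteratedFDeriv] at h
    have hp1 : (p n fun _ => (1 : ℂ)) = c n := by
      simp [hp]
    rw [hp1] at h
    rw [taylorCoeff, ← h, nsmul_eq_mul, inv_mul_cancel_left₀]
    exact_mod_cast n.factorial_ne_zero
  refine ⟨⟨f, hfd, fun z hz => indicator_of_notMem hz _, ?_⟩, ?_⟩
  · rw [bddAbove_hardyMean_iff hfd]
    simp only [hcoeff]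
    exact memℓp_two_iff_summable.1 hc
  · exact lp.ext (funext hcoeff)

instance : NormedAddCommGroup HardySpace :=
  NormedAddCommGroup.induced HardySpace (lp (fun _ : ℕ => ℂ) 2) coeffMap coeffMap_injective

theorem norm_eq_norm_coeffMap (f : HardySpace) : ‖f‖ = ‖coeffMap f‖ := rfl

/-- The inner product of `H²`, `⟪f, g⟫ = ∑ₙ conj (aₙ) bₙ` for `f = ∑ aₙ zⁿ` and `g = ∑ bₙ zⁿ`. The
norm it induces is the square root of the supremum of the quadratic means, see
`HardySpace.isLUB_hardyMean`. -/
instance : InnerProductSpace ℂ HardySpace where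
  norm_smul_le c f := by
    rw [norm_eq_norm_coeffMap, norm_eq_norm_coeffMap, map_smul]
    exact norm_smul_le _ _
  inner f g := inner ℂ (coeffMap f) (coeffMap g)
  norm_sq_eq_re_inner f := norm_sq_eq_re_inner (𝕜 := ℂ) (coeffMap f)
  conj_inner_symm f g := inner_conj_symm _ _
  add_left f g h := by rw [map_add, inner_add_left]
  smul_left f g c := by rw [map_smul, inner_smul_left]

/-- `H²` is isometrically isomorphic to `ℓ²` through the Taylor coefficients. -/
def coeffEquiv : HardySpace ≃ₗᵢ[ℂ] lp (fun _ : ℕ => ℂ) 2 where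
  toLinearEquiv := LinearEquiv.ofBijective coeffMap ⟨coeffMap_injective, coeffMap_surjective⟩
  norm_map' _ := rfl

instance : CompleteSpace HardySpace :=
  (completeSpace_congr (e := coeffEquiv.toEquiv) coeffEquiv.isometry.isUniformEmbedding).2
    inferInstance

theorem norm_sq_eq_tsum (f : HardySpace) : ‖f‖ ^ 2 = ∑' n, ‖taylorCoeff f n‖ ^ 2 := by
  have h := lp.norm_rpow_eq_tsum (p := 2) (by norm_num) (coeffMap f)
  rw [norm_eq_norm_coeffMap]
  simpa [coeffMap_apply] using h

/-- `‖f‖² = sup_{0 < r < 1} (1 / 2π) ∫₀^{2π} |f (r e^{it})|² dt`. -/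
theorem isLUB_hardyMean (f : HardySpace) : IsLUB (hardyMean f '' Ioo 0 1) (‖f‖ ^ 2) := by
  rw [norm_sq_eq_tsum]
  exact ⟨hardyMean_le_tsum f.differentiableOn
    ((bddAbove_hardyMean_iff f.differentiableOn).1 f.bddAbove_hardyMean),
    fun _ hC => (summable_of_bddAbove_hardyMean f.differentiableOn hC).2⟩

end HardySpace

/-! ### Weighted composition operators and Schatten classes -/

/-- The bounded operator `T` on `H²` is the weighted composition operator
`M_w C_φ : f ↦ w · (f ∘ φ)`. -/
def IsWeightedComposition (w : HardySpace) (φ : ℂ → ℂ) (T : HardySpace →L[ℂ] HardySpace) : Prop :=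
  ∀ f : HardySpace, ∀ z ∈ ball (0 : ℂ) 1, T f z = w z * f (φ z)

section Schatten

/-- The modulus `|T| = √(T* T)` of a bounded operator between complex Hilbert spaces. -/
def operatorModulus {H₁ H₂ : Type*} [NormedAddCommGroup H₁] [InnerProductSpace ℂ H₁]
    [CompleteSpace H₁] [NormedAddCommGroup H₂] [InnerProductSpace ℂ H₂] [CompleteSpace H₂]
    (T : H₁ →L[ℂ] H₂) : H₁ →L[ℂ] H₁ :=
  CFC.sqrt (ContinuousLinearMap.adjoint T ∘L T)

/-- The multiplicity of `s` as a singular number of the compact operator `T`, that is, the dimension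
of the eigenspace of `|T|` for the eigenvalue `s` (it is `0` if `s` is not an eigenvalue). -/
def singularMultiplicity {H₁ H₂ : Type*} [NormedAddCommGroup H₁] [InnerProductSpace ℂ H₁]
    [CompleteSpace H₁] [NormedAddCommGroup H₂] [InnerProductSpace ℂ H₂] [CompleteSpace H₂]
    (T : H₁ →L[ℂ] H₂) (s : ℝ) : ℕ :=
  Module.finrank ℂ
    (Module.End.eigenspace (operatorModulus T : H₁ →ₗ[ℂ] H₁) (s : ℂ))

/-- `T` belongs to the Schatten class `S_p` (`p > 0`): it is compact and its singular numbers, the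
eigenvalues of `|T|` repeated according to multiplicity, are `p`-summable. The sum is arranged by
distinct values `s > 0`; the eigenvalue `0` contributes nothing. For `p = 2` this is the
Hilbert–Schmidt class. -/
def MemSchatten {H₁ H₂ : Type*} [NormedAddCommGroup H₁] [InnerProductSpace ℂ H₁]
    [CompleteSpace H₁] [NormedAddCommGroup H₂] [InnerProductSpace ℂ H₂] [CompleteSpace H₂]
    (p : ℝ) (T : H₁ →L[ℂ] H₂) : Prop :=
  IsCompactOperator T ∧
    Summable fun s : Ioi (0 : ℝ) => (singularMultiplicity T s : ℝ) * (s : ℝ) ^ p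

end Schatten

end

/-! ### Singular vectors and Schatten classes via orthonormal bases -/

section SingularVectors

open ContinuousLinearMap

variable {H₁ H₂ : Type*} [NormedAddCommGroup H₁] [InnerProductSpace ℂ H₁]
  [CompleteSpace H₁] [NormedAddCommGroup H₂] [InnerProductSpace ℂ H₂] [CompleteSpace H₂]

/-! The Hilbert–Schmidt hypothesis matters only through one consequence: `φ` does not approach the
unit circle too often, in the sense that `log (1 / (1 - |φ|))` has bounded circular means. Summing
`‖T₀ zⁿ‖²` as a geometric series bounds the means of `|w₀|² / (1 - |φ|²)`. Jensen's formula bounds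
the means of `log |w₀|` from below, and `log x ≤ x - 1` combines the two
(`exists_circleAverage_neg_log_le`).

By Fatou the boundary function `ψ` of `φ` satisfies `|ψ| < 1` almost everywhere, and `h = log (1 /
(1 - |ψ|))` is integrable (`exists_boundary_function`). A de la Vallée-Poussin argument gives `Ψ` of
superlinear growth with `Ψ ∘ h` still integrable (`exists_superlinear_integrable_comp`). The weight
is the outer function with `log |w|` equal to minus the Poisson integral of `Ψ ∘ h`. Since `Ψ x ≥ N
x - C`, and `log (1 / (1 - s))` is convex and increasing while `|φ|` is at most the Poisson integral
of `|ψ|`, Jensen's inequality yields `|w| ≤ e^C (1 - |φ|)^N` for every `N`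
(`exists_weight_le_one_sub_norm_pow`).

Such a weight makes `‖w φⁿ‖` decay faster than every power of `n`, because `sⁿ (1 - s)^N =
O(n^(-N))` on `[0, 1]`. Hence `∑ ‖T zⁿ‖^p < ∞` for every `p > 0`, which for `p ≤ 2` forces
membership in `S_p` (`memSchatten_of_summable_rpow_norm_apply`). -/

theorem operatorModulus_isPositive (T : H₁ →L[ℂ] H₂) : (operatorModulus T).IsPositive :=
  (nonneg_iff_isPositive _).1 (CFC.sqrt_nonneg _)

theorem operatorModulus_apply_apply (T : H₁ →L[ℂ] H₂) (x : H₁) :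
    operatorModulus T (operatorModulus T x) = adjoint T (T x) := by
  have h := CFC.sqrt_mul_sqrt_self (adjoint T ∘L T)
    ((nonneg_iff_isPositive _).2 (isPositive_adjoint_comp_self T))
  exact congrArg (fun S : H₁ →L[ℂ] H₁ => S x) h

theorem inner_operatorModulus_left (T : H₁ →L[ℂ] H₂) (x y : H₁) :
    inner ℂ (operatorModulus T x) y = inner ℂ x (operatorModulus T y) :=
  (operatorModulus_isPositive T).isSymmetric x y

theorem norm_operatorModulus_apply (T : H₁ →L[ℂ] H₂) (x : H₁) :
    ‖operatorModulus T x‖ = ‖T x‖ := by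
  have h : inner ℂ (operatorModulus T x) (operatorModulus T x) = inner ℂ (T x) (T x) := by
    rw [inner_operatorModulus_left, operatorModulus_apply_apply, adjoint_inner_right]
  rw [inner_self_eq_norm_sq_to_K, inner_self_eq_norm_sq_to_K] at h
  have h' : ‖operatorModulus T x‖ ^ 2 = ‖T x‖ ^ 2 := by exact_mod_cast h
  exact (pow_left_inj₀ (norm_nonneg _) (norm_nonneg _) two_ne_zero).1 h'

/-- For the converse, `y = |T| x - s x` satisfies `|T| y = -s y`, which positivity of `|T|` allows
only for `y = 0`. This transfers spectral questions about `|T|` to the operator `T* T`, whose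
compactness is immediate. -/
theorem operatorModulus_apply_eq_smul_iff (T : H₁ →L[ℂ] H₂) {s : ℝ} (hs : 0 < s) (x : H₁) :
    operatorModulus T x = (s : ℂ) • x ↔ adjoint T (T x) = ((s ^ 2 : ℝ) : ℂ) • x := by
  constructor
  · intro h
    rw [← operatorModulus_apply_apply, h, map_smul, h, smul_smul]
    push_cast
    rw [sq]
  · intro h
    set y := operatorModulus T x - (s : ℂ) • x with hy
    have h1 : operatorModulus T y = -((s : ℂ) • y) := by
      rw [hy, map_sub, operatorModulus_apply_apply, h, map_smul, smul_sub, smul_smul]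
      push_cast
      rw [sq]
      abel
    have h2 := (operatorModulus_isPositive T).re_inner_nonneg_left y
    rw [h1, inner_neg_left, inner_smul_left, inner_self_eq_norm_sq_to_K] at h2
    have h3 : 0 ≤ -(s * ‖y‖ ^ 2) := by
      have he : (-((starRingEnd ℂ) (s : ℂ) * ((‖y‖ : ℝ) : ℂ) ^ 2)) =
          ((-(s * ‖y‖ ^ 2) : ℝ) : ℂ) := by
        rw [Complex.conj_ofReal]
        push_cast
        ring
      rw [← Complex.ofReal_re (-(s * ‖y‖ ^ 2)), ← he]
      exact h2
    have h4 : ‖y‖ ^ 2 = 0 := by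
      have := sq_nonneg ‖y‖
      nlinarith
    exact sub_eq_zero.1 (norm_eq_zero.1 (pow_eq_zero_iff two_ne_zero |>.1 h4))

theorem finiteDimensional_eigenspace_operatorModulus {T : H₁ →L[ℂ] H₂} (hT : IsCompactOperator T)
    {s : ℝ} (hs : 0 < s) :
    FiniteDimensional ℂ
      (Module.End.eigenspace (operatorModulus T : H₁ →ₗ[ℂ] H₁) (s : ℂ)) := by
  have hA : IsCompactOperator (adjoint T ∘L T) := hT.clm_comp (adjoint T)
  have hs' : ((s ^ 2 : ℝ) : ℂ) ≠ 0 := by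
    exact_mod_cast (pow_pos hs 2).ne'
  have := finite_dimensional_eigenspace hA _ hs'
  refine Submodule.finiteDimensional_of_le (S₂ := Module.End.eigenspace
    (adjoint T ∘L T).toLinearMap ((s ^ 2 : ℝ) : ℂ)) fun x hx => ?_
  rw [Module.End.mem_eigenspace_iff] at hx ⊢
  exact (operatorModulus_apply_eq_smul_iff T hs x).1 hx

/-- Index set of the singular numbers `s > 0` of `T`, repeated according to multiplicity. -/
abbrev SingularIndex (T : H₁ →L[ℂ] H₂) : Type :=
  Σ s : Ioi (0 : ℝ), Fin (singularMultiplicity T s)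

/-- The spectral theorem for the compact symmetric operator `T* T`: the vector `T* T x` is
orthogonal to all its eigenspaces, hence zero. -/
theorem apply_eq_zero_of_forall_inner_eigenvector_eq_zero {T : H₁ →L[ℂ] H₂}
    (hT : IsCompactOperator T) {x : H₁}
    (hx : ∀ s : ℝ, 0 < s → ∀ y, operatorModulus T y = (s : ℂ) • y → inner ℂ y x = 0) :
    T x = 0 := by
  set A : H₁ →L[ℂ] H₁ := adjoint T ∘L T with hA
  have hAc : IsCompactOperator A := hT.clm_comp (adjoint T)
  have hAs : A.IsSymmetric := (isPositive_adjoint_comp_self T).isSymmetric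
  have hbot := orthogonalComplement_iSup_eigenspaces_eq_bot hAc hAs
  have hmem : A x ∈ (⨆ μ, Module.End.eigenspace (A : Module.End ℂ H₁) μ)ᗮ := by
    rw [← Submodule.iInf_orthogonal, Submodule.mem_iInf]
    intro μ
    rw [Submodule.mem_orthogonal]
    intro y hy
    rw [Module.End.mem_eigenspace_iff] at hy
    have hy' : adjoint T (T y) = μ • y := hy
    refine (hAs y x).symm.trans ?_
    change inner ℂ (adjoint T (T y)) x = 0
    rw [hy', inner_smul_left]
    rcases eq_or_ne y 0 with rfl | hy0
    · simp
    have h1 : (‖T y‖ ^ 2 : ℂ) = μ * (‖y‖ ^ 2 : ℂ) := by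
      have h := inner_self_eq_norm_sq_to_K (𝕜 := ℂ) (T y)
      rw [← adjoint_inner_right, hy', inner_smul_right, inner_self_eq_norm_sq_to_K] at h
      exact h.symm
    have hny : 0 < ‖y‖ := norm_pos_iff.2 hy0
    -- The eigenvalue is a square `s²` with `s ≥ 0`. For `s = 0` the factor `μ` vanishes; for `s >
    -- 0`, `y` is an eigenvector of `|T|` and the hypothesis on `x` applies.
    have h2 : μ = ((‖T y‖ / ‖y‖) ^ 2 : ℝ) := by
      have : (‖y‖ : ℂ) ≠ 0 := by exact_mod_cast hny.ne'
      push_cast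
      field_simp
      exact h1.symm
    rcases (div_nonneg (norm_nonneg (T y)) hny.le).eq_or_lt with h0 | h0
    · rw [h2, ← h0]
      simp
    · rw [hx _ h0 y ((operatorModulus_apply_eq_smul_iff T h0 y).2 (by rw [hy', h2])), mul_zero]
  rw [hbot, Submodule.mem_bot] at hmem
  have h : inner ℂ (T x) (T x) = 0 := by
    rw [← adjoint_inner_right]
    change inner ℂ x (A x) = 0
    rw [hmem, inner_zero_right]
  exact inner_self_eq_zero.1 h

/-- A compact operator has an orthonormal family of singular vectors, indexed by its singular
numbers, whose orthogonal complement is the kernel. -/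
theorem exists_orthonormal_singularVectors {T : H₁ →L[ℂ] H₂} (hT : IsCompactOperator T) :
    ∃ f : SingularIndex T → H₁, Orthonormal ℂ f ∧
      (∀ i, operatorModulus T (f i) = ((i.1 : ℝ) : ℂ) • f i) ∧
      ∀ x, (∀ i, inner ℂ (f i) x = 0) → T x = 0 := by
  have hfd (s : Ioi (0 : ℝ)) := finiteDimensional_eigenspace_operatorModulus hT s.2
  let b (s : Ioi (0 : ℝ)) := stdOrthonormalBasis ℂ
    (Module.End.eigenspace (operatorModulus T : H₁ →ₗ[ℂ] H₁) ((s : ℝ) : ℂ))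
  have hsymm : (operatorModulus T : H₁ →ₗ[ℂ] H₁).IsSymmetric :=
    (operatorModulus_isPositive T).isSymmetric
  have hinj : Function.Injective fun s : Ioi (0 : ℝ) => ((s : ℝ) : ℂ) :=
    Complex.ofReal_injective.comp Subtype.val_injective
  have hort := (hsymm.orthogonalFamily_eigenspaces.comp hinj).orthonormal_sigma_orthonormal
    (v_family := fun s => b s) fun s => (b s).orthonormal
  refine ⟨fun i => (b i.1 i.2 : H₁), hort, fun i => ?_, fun x hx => ?_⟩
  · exact Module.End.mem_eigenspace_iff.1 (b i.1 i.2).2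
  · refine apply_eq_zero_of_forall_inner_eigenvector_eq_zero hT fun s hs y hy => ?_
    have hy' : y ∈ Module.End.eigenspace (operatorModulus T : H₁ →ₗ[ℂ] H₁) (s : ℂ) :=
      Module.End.mem_eigenspace_iff.2 hy
    have hsum := congrArg Subtype.val ((b ⟨s, hs⟩).sum_repr ⟨y, hy'⟩)
    rw [Submodule.coe_sum] at hsum
    rw [← show _ = y from hsum, sum_inner]
    refine Finset.sum_eq_zero fun j _ => ?_
    rw [Submodule.coe_smul, inner_smul_left]
    have := hx ⟨⟨s, hs⟩, j⟩
    simp only at this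
    rw [this, mul_zero]

theorem memSchatten_iff_tsum_ne_top {T : H₁ →L[ℂ] H₂} (hT : IsCompactOperator T) (p : ℝ) :
    MemSchatten p T ↔ ∑' i : SingularIndex T, ENNReal.ofReal ((i.1 : ℝ) ^ p) ≠ ⊤ := by
  have h0 (s : Ioi (0 : ℝ)) : 0 ≤ (singularMultiplicity T s : ℝ) * (s : ℝ) ^ p :=
    mul_nonneg (Nat.cast_nonneg _) (Real.rpow_nonneg s.2.le _)
  have h1 : ∑' i : SingularIndex T, ENNReal.ofReal ((i.1 : ℝ) ^ p) =
      ∑' s : Ioi (0 : ℝ), ENNReal.ofReal ((singularMultiplicity T s : ℝ) * (s : ℝ) ^ p) := by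
    rw [ENNReal.tsum_sigma fun (s : Ioi (0 : ℝ)) (_ : Fin (singularMultiplicity T s)) =>
      ENNReal.ofReal ((s : ℝ) ^ p)]
    refine tsum_congr fun s => ?_
    rw [tsum_fintype, Finset.sum_const, Finset.card_univ, Fintype.card_fin, nsmul_eq_mul,
      ENNReal.ofReal_mul (Nat.cast_nonneg _), ENNReal.ofReal_natCast]
  rw [h1]
  refine ⟨fun h => h.2.tsum_ofReal_ne_top, fun h => ⟨hT, ?_⟩⟩
  have := ENNReal.summable_toReal h
  simpa only [ENNReal.toReal_ofReal (h0 _)] using this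

theorem tsum_ofReal_sq_norm_inner {ι H : Type*} [NormedAddCommGroup H] [InnerProductSpace ℂ H]
    (b : HilbertBasis ι ℂ H) (x : H) :
    ∑' i, ENNReal.ofReal (‖inner ℂ (b i) x‖ ^ 2) = ENNReal.ofReal (‖x‖ ^ 2) := by
  rw [← ENNReal.ofReal_tsum_of_nonneg (fun _ => sq_nonneg _)
    (b.orthonormal.inner_products_summable x)]
  congr 1
  have h := b.tsum_inner_mul_inner x x
  have h2 (i : ι) : inner ℂ x (b i) * inner ℂ (b i) x = ((‖inner ℂ (b i) x‖ ^ 2 : ℝ) : ℂ) := by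
    rw [← inner_conj_symm, RCLike.conj_mul]
    norm_cast
  simp only [h2] at h
  rw [inner_self_eq_norm_sq_to_K, ← Complex.ofReal_tsum] at h
  exact Complex.ofReal_injective (h.trans (Complex.ofReal_pow _ _).symm)

/-- Both sides are the double sum of `|⟨c j, T (b i)⟩|²`, by Parseval. Used twice, it shows that the
left side does not depend on `b`. -/
theorem tsum_ofReal_sq_norm_apply_eq_adjoint {ι κ : Type*} (T : H₁ →L[ℂ] H₂)
    (b : HilbertBasis ι ℂ H₁) (c : HilbertBasis κ ℂ H₂) :
    ∑' i, ENNReal.ofReal (‖T (b i)‖ ^ 2) = ∑' j, ENNReal.ofReal (‖adjoint T (c j)‖ ^ 2) := by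
  simp only [← tsum_ofReal_sq_norm_inner c (T _), ← tsum_ofReal_sq_norm_inner b (adjoint T _)]
  rw [ENNReal.tsum_comm]
  refine tsum_congr fun j => tsum_congr fun i => ?_
  rw [adjoint_inner_right, norm_inner_symm]

/-- An operator of the Schatten class `S₂` is a Hilbert–Schmidt operator. -/
theorem MemSchatten.summable_sq_norm_apply {T : H₁ →L[ℂ] H₂} (hT : MemSchatten 2 T) {ι : Type*}
    (b : HilbertBasis ι ℂ H₁) : Summable fun i => ‖T (b i)‖ ^ 2 := by
  obtain ⟨f, hf, hTf, hker⟩ := exists_orthonormal_singularVectors hT.1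
  -- The basis `c` completes the singular vectors, and the added vectors lie in the kernel of `T`.
  -- The basis `d` of `H₂` is arbitrary and only mediates the change from `b` to `c`.
  obtain ⟨w, c, hw, hc⟩ := hf.toSubtypeRange.exists_hilbertBasis_extension
  obtain ⟨v, d, -, -⟩ := (orthonormal_empty ℂ H₂).exists_hilbertBasis_extension
  have hfin := (memSchatten_iff_tsum_ne_top hT.1 2).1 hT
  have hsum : ∑' i, ENNReal.ofReal (‖T (b i)‖ ^ 2) =
      ∑' i : SingularIndex T, ENNReal.ofReal ((i.1 : ℝ) ^ (2 : ℝ)) := by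
    rw [tsum_ofReal_sq_norm_apply_eq_adjoint T b d, ← tsum_ofReal_sq_norm_apply_eq_adjoint T c d]
    let e : SingularIndex T → w := fun i => ⟨f i, hw (mem_range_self i)⟩
    have he : Function.Injective e := fun i j hij =>
      hf.linearIndependent.injective (congrArg Subtype.val hij)
    rw [← he.tsum_eq (f := fun i => ENNReal.ofReal (‖T (c i)‖ ^ 2))]
    · refine tsum_congr fun i => ?_
      have hce : c (e i) = f i := by rw [hc]
      rw [hce, ← norm_operatorModulus_apply, hTf, norm_smul, hf.1, mul_one, Complex.norm_real,
        Real.norm_of_nonneg i.1.2.le]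
      norm_num
    · intro x hx
      by_contra hxe
      refine hx ?_
      have : T (c x) = 0 := by
        refine hker _ fun i => ?_
        have hce : c (e i) = f i := by rw [hc]
        rw [← hce]
        exact c.orthonormal.2 fun h => hxe ⟨i, h⟩
      simp [this]
  rw [← hsum] at hfin
  have := ENNReal.summable_toReal hfin
  simpa only [ENNReal.toReal_ofReal (sq_nonneg _)] using this

/-- The first term suffices when `s ≤ x`, the second when `s ≥ x`. Bounding `s ^ p` by a constant
plus a multiple of `s ^ 2` replaces Jensen's inequality for the concave power `p / 2`, at the cost
of a factor `2`. -/
theorem rpow_le_rpow_add_rpow_sub_two_mul_sq {s x p : ℝ} (hs : 0 < s) (hx : 0 < x) (hp : 0 ≤ p)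
    (hp2 : p ≤ 2) : s ^ p ≤ x ^ p + x ^ (p - 2) * s ^ 2 := by
  rcases le_total s x with h | h
  · have := Real.rpow_le_rpow hs.le h hp
    have : 0 ≤ x ^ (p - 2) * s ^ 2 := by positivity
    linarith
  · have h1 : s ^ p = s ^ (p - 2) * s ^ 2 := by
      rw [← Real.rpow_natCast s 2, ← Real.rpow_add hs]
      norm_num
    have h2 : s ^ (p - 2) ≤ x ^ (p - 2) :=
      Real.rpow_le_rpow_of_nonpos hx h (by linarith)
    have : 0 ≤ x ^ p := by positivity
    rw [h1]
    nlinarith [mul_le_mul_of_nonneg_right h2 (sq_nonneg s)]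

/-- A compact operator `T` with `∑ ‖T bₙ‖ ^ p < ∞` for some orthonormal basis `b` and `0 < p ≤ 2`
belongs to the Schatten class `S_p`. -/
theorem memSchatten_of_summable_rpow_norm_apply {T : H₁ →L[ℂ] H₂} (hT : IsCompactOperator T)
    {ι : Type*} (b : HilbertBasis ι ℂ H₁) {p : ℝ} (hp : 0 < p) (hp2 : p ≤ 2)
    (hs : Summable fun n => ‖T (b n)‖ ^ p) : MemSchatten p T := by
  obtain ⟨f, hf, hTf, -⟩ := exists_orthonormal_singularVectors hT
  rw [memSchatten_iff_tsum_ne_top hT]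
  have h1 (i : SingularIndex T) : ENNReal.ofReal ((i.1 : ℝ) ^ p) =
      ∑' n, ENNReal.ofReal ((i.1 : ℝ) ^ p * ‖inner ℂ (f i) (b n)‖ ^ 2) := by
    have h := tsum_ofReal_sq_norm_inner b (f i)
    rw [hf.1, one_pow, ENNReal.ofReal_one] at h
    simp only [ENNReal.ofReal_mul (Real.rpow_nonneg i.1.2.le p), ENNReal.tsum_mul_left,
      norm_inner_symm (f i), h, mul_one]
  have h2 (i : SingularIndex T) (x : H₁) :
      (i.1 : ℝ) ^ 2 * ‖inner ℂ (f i) x‖ ^ 2 = ‖inner ℂ (f i) (operatorModulus T x)‖ ^ 2 := by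
    rw [← inner_operatorModulus_left, hTf, inner_smul_left, norm_mul, mul_pow]
    simp
  -- The constant `2` comes from applying Bessel's inequality to `b n` and to `|T| (b n)`, after the
  -- preceding inequality with `x = ‖T (b n)‖`. The case `T (b n) = 0` is separate because of the
  -- negative power `x ^ (p - 2)`.
  have h3 (n : ι) : ∑' i, ENNReal.ofReal ((i.1 : ℝ) ^ p * ‖inner ℂ (f i) (b n)‖ ^ 2) ≤
      ENNReal.ofReal (2 * ‖T (b n)‖ ^ p) := by
    rcases (norm_nonneg (T (b n))).eq_or_lt with h0 | h0
    · have hz (i : SingularIndex T) : ‖inner ℂ (f i) (b n)‖ ^ 2 = 0 := by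
        have := h2 i (b n)
        have hm : operatorModulus T (b n) = 0 := by
          rw [← norm_eq_zero, norm_operatorModulus_apply, ← h0]
        rw [hm, inner_zero_right, norm_zero, zero_pow two_ne_zero] at this
        exact (mul_eq_zero.1 this).resolve_left (pow_pos i.1.2 2).ne'
      simp [hz]
    · set X := ‖T (b n)‖ with hX
      have hc := hf.inner_products_summable (b n)
      have hcl := hf.tsum_inner_products_le (b n)
      have hd := hf.inner_products_summable (operatorModulus T (b n))
      have hdl := hf.tsum_inner_products_le (operatorModulus T (b n))
      rw [norm_operatorModulus_apply, ← hX] at hdl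
      rw [b.orthonormal.1, one_pow] at hcl
      calc ∑' i, ENNReal.ofReal ((i.1 : ℝ) ^ p * ‖inner ℂ (f i) (b n)‖ ^ 2)
          ≤ ∑' i, ENNReal.ofReal (X ^ p * ‖inner ℂ (f i) (b n)‖ ^ 2 +
              X ^ (p - 2) * ‖inner ℂ (f i) (operatorModulus T (b n))‖ ^ 2) := by
            refine ENNReal.tsum_le_tsum fun i => ENNReal.ofReal_le_ofReal ?_
            rw [← h2, ← mul_assoc, ← add_mul]
            exact mul_le_mul_of_nonneg_right
              (rpow_le_rpow_add_rpow_sub_two_mul_sq i.1.2 h0 hp.le hp2) (sq_nonneg _)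
        _ = ENNReal.ofReal (∑' i, (X ^ p * ‖inner ℂ (f i) (b n)‖ ^ 2 +
              X ^ (p - 2) * ‖inner ℂ (f i) (operatorModulus T (b n))‖ ^ 2)) :=
            (ENNReal.ofReal_tsum_of_nonneg (fun i => by positivity)
              ((hc.mul_left _).add (hd.mul_left _))).symm
        _ ≤ ENNReal.ofReal (2 * X ^ p) := by
            refine ENNReal.ofReal_le_ofReal ?_
            rw [(hc.mul_left _).tsum_add (hd.mul_left _), tsum_mul_left, tsum_mul_left]
            have e : X ^ (p - 2) * X ^ 2 = X ^ p := by
              rw [← Real.rpow_natCast X 2, ← Real.rpow_add h0]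
              norm_num
            have a1 := mul_le_mul_of_nonneg_left hcl (Real.rpow_nonneg h0.le p)
            have a2 := mul_le_mul_of_nonneg_left hdl (Real.rpow_nonneg h0.le (p - 2))
            linarith
  simp only [h1]
  rw [ENNReal.tsum_comm]
  exact ne_top_of_le_ne_top (hs.mul_left 2).tsum_ofReal_ne_top (ENNReal.tsum_le_tsum h3)

end SingularVectors

/-! ### Compactness from summability along a basis -/

section SummableBasis

variable {H₁ H₂ : Type*} [NormedAddCommGroup H₁] [InnerProductSpace ℂ H₁]
  [NormedAddCommGroup H₂] [InnerProductSpace ℂ H₂] [CompleteSpace H₂]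

theorem isCompactOperator_smulRight {E F : Type*} [NormedAddCommGroup E] [NormedSpace ℂ E]
    [NormedAddCommGroup F] [NormedSpace ℂ F] (ℓ : E →L[ℂ] ℂ) (y : F) :
    IsCompactOperator (ℓ.smulRight y) := by
  have h : IsCompactOperator ((ContinuousLinearMap.id ℂ ℂ).smulRight y) :=
    (isCompactOperator_id_iff_locallyCompactSpace.2 inferInstance).clm_comp
      ((ContinuousLinearMap.id ℂ ℂ).smulRight y)
  exact h.comp_clm ℓ

/-- The rank-one pieces `x ↦ ⟨b n, x⟩ T (b n)` sum absolutely in operator norm to `T`, and compact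
operators form a closed set. -/
theorem isCompactOperator_of_summable_norm_apply {ι : Type*} (b : HilbertBasis ι ℂ H₁)
    (T : H₁ →L[ℂ] H₂) (hs : Summable fun n => ‖T (b n)‖) : IsCompactOperator T := by
  set R : ι → H₁ →L[ℂ] H₂ := fun n => (innerSL ℂ (b n)).smulRight (T (b n)) with hR
  have hRs : Summable R := by
    refine Summable.of_norm ?_
    simpa only [hR, ContinuousLinearMap.norm_smulRight_apply, innerSL_apply_norm,
      b.orthonormal.1, one_mul] using hs
  have hT : T = ∑' n, R n := by
    refine ContinuousLinearMap.ext fun x => ?_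
    have h1 : HasSum (fun n => R n x) ((∑' n, R n) x) :=
      hRs.hasSum.mapL (ContinuousLinearMap.apply ℂ H₂ x)
    have h2 : HasSum (fun n => R n x) (T x) := by
      have := (b.hasSum_repr x).mapL T
      simpa [hR, b.repr_apply_apply] using this
    exact h2.unique h1
  rw [hT]
  refine isClosed_setOfPred_isCompactOperator.mem_of_tendsto hRs.hasSum
    (Eventually.of_forall fun s => ?_)
  exact (compactOperator (RingHom.id ℂ) H₁ H₂).sum_mem fun n _ =>
    isCompactOperator_smulRight _ _

end SummableBasis

/-! ### Bounded functions, point evaluations and monomials in `H²` -/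

namespace HardySpace

theorem hardyMean_le_sq {f : ℂ → ℂ} {C : ℝ} (hC : ∀ z ∈ ball (0 : ℂ) 1, ‖f z‖ ≤ C) {r : ℝ}
    (hr : r ∈ Ioo (0 : ℝ) 1) : hardyMean f r ≤ C ^ 2 := by
  have h : ‖∫ t in (0 : ℝ)..2 * Real.pi, ‖f (r * Complex.exp (t * Complex.I))‖ ^ 2‖ ≤
      C ^ 2 * |2 * Real.pi - 0| := by
    refine intervalIntegral.norm_integral_le_of_norm_le_const fun t _ => ?_
    rw [Real.norm_of_nonneg (sq_nonneg _)]
    refine pow_le_pow_left₀ (norm_nonneg _) (hC _ ?_) 2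
    rw [mem_ball_zero_iff, norm_mul, Complex.norm_exp_ofReal_mul_I, mul_one, Complex.norm_real,
      Real.norm_of_nonneg hr.1.le]
    exact hr.2
  rw [sub_zero, abs_of_pos Real.two_pi_pos] at h
  rw [hardyMean, inv_mul_le_iff₀ Real.two_pi_pos, mul_comm (2 * Real.pi)]
  exact (le_abs_self _).trans h

/-- A bounded analytic function on the disk as an element of `H²`. -/
noncomputable def ofBounded (f : ℂ → ℂ) (hf : DifferentiableOn ℂ f (ball 0 1))
    (hb : ∃ C, ∀ z ∈ ball (0 : ℂ) 1, ‖f z‖ ≤ C) : HardySpace :=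
  ⟨(ball (0 : ℂ) 1).indicator f, hf.congr fun z hz => indicator_of_mem hz f,
    fun z hz => indicator_of_notMem hz f, by
      obtain ⟨C, hC⟩ := hb
      refine ⟨C ^ 2, ?_⟩
      rintro _ ⟨r, hr, rfl⟩
      refine hardyMean_le_sq (fun z hz => ?_) hr
      rw [indicator_of_mem hz]
      exact hC z hz⟩

theorem ofBounded_apply (f : ℂ → ℂ) (hf : DifferentiableOn ℂ f (ball 0 1))
    (hb : ∃ C, ∀ z ∈ ball (0 : ℂ) 1, ‖f z‖ ≤ C) {z : ℂ} (hz : z ∈ ball (0 : ℂ) 1) :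
    ofBounded f hf hb z = f z := indicator_of_mem hz f

theorem norm_le_of_forall_norm_apply_le (f : HardySpace) {C : ℝ} (hC0 : 0 ≤ C)
    (hC : ∀ z ∈ ball (0 : ℂ) 1, ‖f z‖ ≤ C) : ‖f‖ ≤ C := by
  refine (sq_le_sq₀ (norm_nonneg _) hC0).1 (f.isLUB_hardyMean.2 ?_)
  rintro _ ⟨r, hr, rfl⟩
  exact hardyMean_le_sq hC hr

theorem norm_taylorCoeff_le (f : HardySpace) (n : ℕ) : ‖taylorCoeff f n‖ ≤ ‖f‖ :=
  lp.norm_apply_le_norm (by norm_num) (coeffMap f) n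

/-- Each coefficient is at most `‖f‖`, so a geometric series suffices. The exponent of `1 - ‖z‖` is
not sharp, but the weight absorbs any power. -/
theorem norm_apply_mul_le (f : HardySpace) {z : ℂ} (hz : z ∈ ball (0 : ℂ) 1) :
    ‖f z‖ * (1 - ‖z‖) ≤ ‖f‖ := by
  rw [mem_ball_zero_iff] at hz
  have hg := (hasSum_geometric_of_lt_one (norm_nonneg z) hz).mul_left ‖f‖
  have h : ‖f z‖ ≤ ‖f‖ * (1 - ‖z‖)⁻¹ :=
    (hasSum_taylorCoeff f.differentiableOn (mem_ball_zero_iff.2 hz)).norm_le_of_bounded hg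
      fun n => by
        rw [norm_mul, norm_pow]
        exact mul_le_mul_of_nonneg_right (f.norm_taylorCoeff_le n) (by positivity)
  rwa [← div_eq_mul_inv, le_div_iff₀ (sub_pos.2 hz)] at h

/-- The orthonormal basis of `H²` consisting of the monomials. -/
noncomputable def monomialBasis : HilbertBasis ℕ ℂ HardySpace := HilbertBasis.ofRepr coeffEquiv

theorem monomialBasis_apply (n : ℕ) {z : ℂ} (hz : z ∈ ball (0 : ℂ) 1) :
    monomialBasis n z = z ^ n := by
  have hc (m : ℕ) : taylorCoeff (monomialBasis n) m = if m = n then 1 else 0 := by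
    have h : coeffMap (monomialBasis n) = lp.single 2 n (1 : ℂ) := by
      change coeffEquiv (monomialBasis n) = _
      exact monomialBasis.repr_self n
    rw [← coeffMap_apply, h, lp.single_apply]
    split_ifs with hm <;> simp_all
  have h := hasSum_taylorCoeff (monomialBasis n).differentiableOn hz
  refine h.unique ?_
  simp only [hc]
  convert hasSum_ite_eq n (z ^ n) using 2 with m
  split_ifs with hm
  · rw [hm, one_mul]
  · rw [zero_mul]

end HardySpace

/-! ### Rapidly decaying weights give operators in all Schatten classes -/

theorem succ_mul_pow_mul_one_sub_le {s : ℝ} (h0 : 0 ≤ s) (h1 : s ≤ 1) (m : ℕ) :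
    (m + 1) * (s ^ m * (1 - s)) ≤ 1 := by
  have h := geom_sum_mul_neg s (m + 1)
  have h2 : (m + 1 : ℝ) * s ^ m ≤ ∑ i ∈ Finset.range (m + 1), s ^ i := by
    have := Finset.card_nsmul_le_sum (Finset.range (m + 1)) (fun i => s ^ i) (s ^ m)
      fun i hi => pow_le_pow_of_le_one h0 h1 (Nat.lt_succ_iff.1 (Finset.mem_range.1 hi))
    simpa using this
  have h3 := mul_le_mul_of_nonneg_right h2 (sub_nonneg.2 h1)
  have h4 : 0 ≤ s ^ (m + 1) := by positivity
  linarith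

/-- Each of the `N` factors `1 - s` is paired with a block `s ^ ⌊n / N⌋`; a pair is at most `1 / (⌊n
/ N⌋ + 1) ≤ N / (n + 1)`. -/
theorem pow_mul_one_sub_pow_le {s : ℝ} (h0 : 0 ≤ s) (h1 : s ≤ 1) {N : ℕ} (hN : N ≠ 0) (n : ℕ) :
    s ^ n * (1 - s) ^ N ≤ (N / (n + 1) : ℝ) ^ N := by
  have hs := sub_nonneg.2 h1
  have hm : (n + 1 : ℝ) ≤ N * ((n / N : ℕ) + 1) := by
    have : n < N * (n / N + 1) := Nat.lt_mul_div_succ n (Nat.pos_of_ne_zero hN)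
    exact_mod_cast this
  have hle : s ^ (n / N) * (1 - s) ≤ N / (n + 1) := by
    rw [le_div_iff₀ (by positivity)]
    have h := succ_mul_pow_mul_one_sub_le h0 h1 (n / N)
    have h' : 0 ≤ s ^ (n / N) * (1 - s) := by positivity
    have hN' : (0 : ℝ) ≤ N := by positivity
    nlinarith [mul_le_mul_of_nonneg_left hm h', mul_le_mul_of_nonneg_left h hN']
  calc s ^ n * (1 - s) ^ N ≤ s ^ (n / N * N) * (1 - s) ^ N := by
        refine mul_le_mul_of_nonneg_right ?_ (by positivity)
        exact pow_le_pow_of_le_one h0 h1 (Nat.div_mul_le_self n N)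
    _ = (s ^ (n / N) * (1 - s)) ^ N := by rw [mul_pow, pow_mul]
    _ ≤ _ := pow_le_pow_left₀ (by positivity) hle N

/-- If the weight `w` decays faster than every power of `1 - |φ|`, then `M_w C_φ` is bounded and
belongs to all Schatten classes. -/
theorem exists_isWeightedComposition_memSchatten {φ : ℂ → ℂ}
    (hφ : DifferentiableOn ℂ φ (ball 0 1)) (hφ_maps : MapsTo φ (ball 0 1) (ball 0 1))
    (w : HardySpace)
    (hw : ∀ N : ℕ, ∃ C : ℝ, ∀ z ∈ ball (0 : ℂ) 1, ‖w z‖ ≤ C * (1 - ‖φ z‖) ^ N) :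
    ∃ T : HardySpace →L[ℂ] HardySpace, IsWeightedComposition w φ T ∧
      ∀ p : ℝ, 0 < p → p < 2 → MemSchatten p T := by
  have hsub {z : ℂ} (hz : z ∈ ball (0 : ℂ) 1) : 0 < 1 - ‖φ z‖ :=
    sub_pos.2 (mem_ball_zero_iff.1 (hφ_maps hz))
  obtain ⟨C₁, hC₁⟩ := hw 1
  have hC₁0 : 0 ≤ C₁ := by
    have h := hC₁ 0 (by simp)
    rw [pow_one] at h
    exact nonneg_of_mul_nonneg_left ((norm_nonneg _).trans h) (hsub (by simp))
  have hbound (f : HardySpace) : ∀ z ∈ ball (0 : ℂ) 1, ‖w z * f (φ z)‖ ≤ C₁ * ‖f‖ := by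
    intro z hz
    rw [norm_mul]
    calc ‖w z‖ * ‖f (φ z)‖ ≤ (C₁ * (1 - ‖φ z‖) ^ 1) * ‖f (φ z)‖ :=
          mul_le_mul_of_nonneg_right (hC₁ z hz) (norm_nonneg _)
      _ = C₁ * (‖f (φ z)‖ * (1 - ‖φ z‖)) := by ring
      _ ≤ C₁ * ‖f‖ := mul_le_mul_of_nonneg_left (f.norm_apply_mul_le (hφ_maps hz)) hC₁0
  have hdiff (f : HardySpace) : DifferentiableOn ℂ (fun z => w z * f (φ z)) (ball 0 1) :=
    w.differentiableOn.mul (f.differentiableOn.comp hφ hφ_maps)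
  let T₁ : HardySpace →ₗ[ℂ] HardySpace :=
    { toFun := fun f => HardySpace.ofBounded _ (hdiff f) ⟨_, hbound f⟩
      map_add' := fun f g => HardySpace.ext_disk fun z hz => by
        simp only [HardySpace.add_apply, HardySpace.ofBounded_apply _ _ _ hz]
        ring
      map_smul' := fun c f => HardySpace.ext_disk fun z hz => by
        simp only [HardySpace.smul_apply, HardySpace.ofBounded_apply _ _ _ hz, RingHom.id_apply]
        ring }
  have hT₁ (f : HardySpace) : ∀ z ∈ ball (0 : ℂ) 1, T₁ f z = w z * f (φ z) := fun z hz =>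
    HardySpace.ofBounded_apply _ (hdiff f) ⟨_, hbound f⟩ hz
  let T := T₁.mkContinuous C₁ fun f =>
    HardySpace.norm_le_of_forall_norm_apply_le _ (by positivity) fun z hz => by
      rw [hT₁ f z hz]
      exact hbound f z hz
  have hdecay (N : ℕ) (hN : N ≠ 0) : ∃ K : ℝ, 0 ≤ K ∧
      ∀ n : ℕ, ‖T (HardySpace.monomialBasis n)‖ ≤ K * (1 / (n + 1 : ℝ)) ^ N := by
    obtain ⟨C, hC⟩ := hw N
    have hC0 : 0 ≤ C := by
      have h := hC 0 (by simp)
      exact nonneg_of_mul_nonneg_left ((norm_nonneg _).trans h) (pow_pos (hsub (by simp)) N)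
    refine ⟨C * N ^ N, by positivity, fun n => ?_⟩
    refine HardySpace.norm_le_of_forall_norm_apply_le _ (by positivity) fun z hz => ?_
    have he : T (HardySpace.monomialBasis n) z = w z * φ z ^ n := by
      rw [← HardySpace.monomialBasis_apply n (hφ_maps hz)]
      exact hT₁ _ z hz
    rw [he, norm_mul, norm_pow]
    calc ‖w z‖ * ‖φ z‖ ^ n ≤ (C * (1 - ‖φ z‖) ^ N) * ‖φ z‖ ^ n :=
          mul_le_mul_of_nonneg_right (hC z hz) (by positivity)
      _ = C * (‖φ z‖ ^ n * (1 - ‖φ z‖) ^ N) := by ring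
      _ ≤ C * (N / (n + 1 : ℝ)) ^ N := by
          refine mul_le_mul_of_nonneg_left ?_ hC0
          exact pow_mul_one_sub_pow_le (norm_nonneg _) (sub_nonneg.1 (hsub hz).le) hN n
      _ = C * N ^ N * (1 / (n + 1 : ℝ)) ^ N := by
          rw [div_eq_mul_one_div, mul_pow, mul_assoc]
  have hsq : Summable fun n : ℕ => (1 / (n + 1 : ℝ)) ^ 2 := by
    have := (summable_nat_add_iff 1).2 (Real.summable_one_div_nat_pow.2 one_lt_two)
    simpa [one_div, inv_pow] using this
  have hcompact : IsCompactOperator T := by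
    obtain ⟨K, -, hK⟩ := hdecay 2 two_ne_zero
    exact isCompactOperator_of_summable_norm_apply HardySpace.monomialBasis T
      (Summable.of_nonneg_of_le (fun _ => norm_nonneg _) hK (hsq.mul_left K))
  refine ⟨T, fun f z hz => hT₁ f z hz, fun p hp hp2 => ?_⟩
  refine memSchatten_of_summable_rpow_norm_apply hcompact HardySpace.monomialBasis hp hp2.le ?_
  -- With `N p ≥ 2`, the `p`-th powers of the norms are dominated by `(n + 1)⁻²`.
  obtain ⟨N, hN⟩ := exists_nat_ge (2 / p)
  have hN0 : N ≠ 0 := by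
    rintro rfl
    exact (div_pos two_pos hp).not_ge (by exact_mod_cast hN)
  rw [div_le_iff₀ hp] at hN
  obtain ⟨K, hK0, hK⟩ := hdecay N hN0
  refine Summable.of_nonneg_of_le (fun _ => by positivity) (fun n => ?_) (hsq.mul_left (K ^ p))
  refine (Real.rpow_le_rpow (norm_nonneg _) (hK n) hp.le).trans ?_
  rw [Real.mul_rpow hK0 (by positivity), ← Real.rpow_natCast _ N, ← Real.rpow_mul (by positivity),
    ← Real.rpow_natCast _ 2]
  refine mul_le_mul_of_nonneg_left ?_ (by positivity)
  refine Real.rpow_le_rpow_of_exponent_ge (by positivity) ?_ (by exact_mod_cast hN)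
  rw [div_le_one (by positivity)]
  linarith [Nat.cast_nonneg (α := ℝ) n]

/-! ### Circular means of `log (1 / (1 - |φ|))` and superlinear integrability -/

section Growth

open MeasureTheory

theorem sphere_subset_unitBall {r : ℝ} (hr : r ∈ Ioo (0 : ℝ) 1) :
    sphere (0 : ℂ) |r| ⊆ ball 0 1 := by
  rw [abs_of_pos hr.1]
  exact sphere_subset_ball hr.2

/-- The circular means of `log |f|` of an analytic function are bounded from below. -/
theorem exists_le_circleAverage_log_norm {f : ℂ → ℂ} (hf : DifferentiableOn ℂ f (ball 0 1)) :
    ∃ c : ℝ, ∀ r ∈ Ico (1 / 2 : ℝ) 1, c ≤ Real.circleAverage (fun z => Real.log ‖f z‖) 0 r := by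
  have hfa := hf.analyticOnNhd isOpen_ball
  -- Jensen's formula: zeros away from the origin contribute nonnegatively, and a zero at the origin
  -- contributes its order times `log r ≥ log (1 / 2)`. This is why radii start at `1 / 2`.
  refine ⟨((meromorphicOrderAt f 0).untop₀ : ℝ) * Real.log (1 / 2) +
    Real.log ‖meromorphicTrailingCoeffAt f 0‖, fun r hr => ?_⟩
  have hr0 : 0 < r := lt_of_lt_of_le (by norm_num) hr.1
  have hsub : closedBall (0 : ℂ) |r| ⊆ ball 0 1 := by
    rw [abs_of_pos hr0]
    exact closedBall_subset_ball hr.2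
  have hfr : AnalyticOnNhd ℂ f (closedBall 0 |r|) := hfa.mono hsub
  have h0 : (0 : ℂ) ∈ closedBall (0 : ℂ) |r| := by simp
  have hdiv := MeromorphicOn.AnalyticOnNhd.divisor_nonneg hfr
  rw [MeromorphicOn.circleAverage_log_norm hr0.ne' hfr.meromorphicOn]
  have h1 : 0 ≤ ∑ᶠ u, (MeromorphicOn.divisor f (closedBall 0 |r|) u : ℝ) *
      Real.log (r * ‖0 - u‖⁻¹) := by
    refine finsum_nonneg fun u => ?_
    by_cases hu : u ∈ closedBall (0 : ℂ) |r|
    · refine mul_nonneg (by exact_mod_cast hdiv u) ?_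
      rw [mem_closedBall_zero_iff, abs_of_pos hr0] at hu
      -- At `u = 0` the conventions `0⁻¹ = 0` and `log 0 = 0` make the term vanish.
      rcases eq_or_ne u 0 with rfl | hu0
      · simp
      · refine Real.log_nonneg ?_
        rw [zero_sub, norm_neg, ← div_eq_mul_inv, one_le_div (norm_pos_iff.2 hu0)]
        exact hu
    · rw [Function.locallyFinsuppWithin.apply_eq_zero_of_notMem _ hu]
      simp
  have h2 : (0 : ℝ) ≤ (MeromorphicOn.divisor f (closedBall 0 |r|) 0 : ℝ) := by
    exact_mod_cast hdiv 0
  rw [MeromorphicOn.divisor_apply hfr.meromorphicOn h0] at h2 ⊢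
  have h3 := mul_le_mul_of_nonneg_left (Real.log_le_log (by norm_num) hr.1) h2
  linarith

/-- This is `log x ≤ x - 1` at `x = a² / (1 - s²)`, with `1 + s ≤ 2`. It is used with `a = |w₀ z|`
and `s = |φ z|`. -/
theorem neg_log_one_sub_le {a s : ℝ} (ha : 0 < a) (hs0 : 0 ≤ s) (hs : s < 1) :
    -Real.log (1 - s) ≤ Real.log 2 + a ^ 2 / (1 - s ^ 2) - 2 * Real.log a := by
  have h1 : 0 < 1 - s := sub_pos.2 hs
  have h2 : 1 - s ^ 2 = (1 - s) * (1 + s) := by ring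
  have h3 : 0 < 1 + s := by linarith
  have h4 := Real.log_le_sub_one_of_pos (show 0 < a ^ 2 / (1 - s ^ 2) by rw [h2]; positivity)
  have h5 : Real.log (1 + s) ≤ Real.log 2 := Real.log_le_log h3 (by linarith)
  rw [Real.log_div (by positivity) (by rw [h2]; positivity), Real.log_pow] at h4
  nth_rewrite 1 [h2] at h4
  rw [Real.log_mul h1.ne' h3.ne'] at h4
  push_cast at h4
  linarith

theorem continuousOn_sq_norm_div_one_sub_sq_norm {φ : ℂ → ℂ} (hφ : DifferentiableOn ℂ φ (ball 0 1))
    (hφ_maps : MapsTo φ (ball 0 1) (ball 0 1)) {w₀ : HardySpace} :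
    ContinuousOn (fun z => ‖w₀ z‖ ^ 2 / (1 - ‖φ z‖ ^ 2)) (ball 0 1) := by
  refine (w₀.differentiableOn.continuousOn.norm.pow 2).div
    (continuousOn_const.sub (hφ.continuousOn.norm.pow 2)) fun z hz => ?_
  have := mem_ball_zero_iff.1 (hφ_maps hz)
  have := pow_lt_one₀ (norm_nonneg (φ z)) this two_ne_zero
  exact (sub_pos.2 this).ne'

/-- The Hilbert–Schmidt condition for `M_w C_φ` as a condition on circular means. -/
theorem circleAverage_sq_norm_div_le {φ : ℂ → ℂ} (hφ : DifferentiableOn ℂ φ (ball 0 1))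
    (hφ_maps : MapsTo φ (ball 0 1) (ball 0 1))
    {w₀ : HardySpace} {T₀ : HardySpace →L[ℂ] HardySpace}
    (hT₀ : IsWeightedComposition w₀ φ T₀)
    (hs : Summable fun n => ‖T₀ (HardySpace.monomialBasis n)‖ ^ 2) {r : ℝ}
    (hr : r ∈ Ioo (0 : ℝ) 1) :
    Real.circleAverage (fun z => ‖w₀ z‖ ^ 2 / (1 - ‖φ z‖ ^ 2)) 0 r ≤
      ∑' n, ‖T₀ (HardySpace.monomialBasis n)‖ ^ 2 := by
  have hsph := sphere_subset_unitBall hr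
  have hmem (t : ℝ) : circleMap 0 r t ∈ ball (0 : ℂ) 1 := hsph (circleMap_mem_sphere' 0 r t)
  have hcw := w₀.differentiableOn.continuousOn.mono hsph
  have hcφ := hφ.continuousOn.mono hsph
  have hG := (continuousOn_sq_norm_div_one_sub_sq_norm hφ hφ_maps (w₀ := w₀)).mono hsph
  have hlt (t : ℝ) : ‖φ (circleMap 0 r t)‖ ^ 2 < 1 :=
    pow_lt_one₀ (norm_nonneg _) (mem_ball_zero_iff.1 (hφ_maps (hmem t))) two_ne_zero
  have hterm (n : ℕ) :
      Real.circleAverage (fun z => ‖w₀ z‖ ^ 2 * (‖φ z‖ ^ 2) ^ n) 0 r ≤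
        ‖T₀ (HardySpace.monomialBasis n)‖ ^ 2 := by
    refine le_trans (le_of_eq ?_)
      ((T₀ (HardySpace.monomialBasis n)).isLUB_hardyMean.1 (mem_image_of_mem _ hr))
    rw [hardyMean_eq_circleAverage]
    refine Real.circleAverage_congr_sphere fun z hz => ?_
    have hz' := hsph hz
    change ‖w₀ z‖ ^ 2 * (‖φ z‖ ^ 2) ^ n = ‖T₀ (HardySpace.monomialBasis n) z‖ ^ 2
    rw [hT₀ _ z hz', HardySpace.monomialBasis_apply n (hφ_maps hz'), norm_mul, norm_pow, mul_pow,
      ← pow_mul, ← pow_mul, mul_comm 2 n]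
  have hint (n : ℕ) : CircleIntegrable (fun z => ‖w₀ z‖ ^ 2 * (‖φ z‖ ^ 2) ^ n) 0 r :=
    ((hcw.norm.pow 2).mul ((hcφ.norm.pow 2).pow n)).circleIntegrable'
  have hpart (N : ℕ) :
      Real.circleAverage (fun z => ∑ n ∈ Finset.range N, ‖w₀ z‖ ^ 2 * (‖φ z‖ ^ 2) ^ n) 0 r ≤
        ∑' n, ‖T₀ (HardySpace.monomialBasis n)‖ ^ 2 := by
    rw [Real.circleAverage_fun_sum fun n _ => hint n]
    exact (Finset.sum_le_sum fun n _ => hterm n).trans (hs.sum_le_tsum _ fun n _ => sq_nonneg _)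
  have hlim (t : ℝ) : HasSum
      (fun n : ℕ => ‖w₀ (circleMap 0 r t)‖ ^ 2 * (‖φ (circleMap 0 r t)‖ ^ 2) ^ n)
      (‖w₀ (circleMap 0 r t)‖ ^ 2 / (1 - ‖φ (circleMap 0 r t)‖ ^ 2)) := by
    rw [div_eq_mul_inv]
    exact (hasSum_geometric_of_lt_one (sq_nonneg _) (hlt t)).mul_left _
  -- The quotient is the geometric series `∑ |w₀|² |φ|^(2n)`; its partial sums are dominated by
  -- their limit, which is continuous on the circle.
  refine le_of_tendsto (f := fun N : ℕ => Real.circleAverage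
    (fun z => ∑ n ∈ Finset.range N, ‖w₀ z‖ ^ 2 * (‖φ z‖ ^ 2) ^ n) 0 r) (x := atTop) ?_
    (Eventually.of_forall hpart)
  simp only [Real.circleAverage_def]
  refine Tendsto.const_smul ?_ _
  refine intervalIntegral.tendsto_integral_filter_of_dominated_convergence
    (fun t => ‖w₀ (circleMap 0 r t)‖ ^ 2 / (1 - ‖φ (circleMap 0 r t)‖ ^ 2)) ?_ ?_ ?_ ?_
  · refine Eventually.of_forall fun N => ?_
    have := CircleIntegrable.fun_sum (Finset.range N) fun n _ => hint n
    have h2 : IntervalIntegrable (fun t => ∑ n ∈ Finset.range N,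
      ‖w₀ (circleMap 0 r t)‖ ^ 2 * (‖φ (circleMap 0 r t)‖ ^ 2) ^ n) volume 0 (2 * Real.pi) := this
    exact (intervalIntegrable_iff.1 h2).aestronglyMeasurable
  · refine Eventually.of_forall fun N => Eventually.of_forall fun t _ => ?_
    rw [Real.norm_of_nonneg (Finset.sum_nonneg fun n _ => by positivity)]
    exact sum_le_hasSum _ (fun n _ => by positivity) (hlim t)
  · exact hG.circleIntegrable'
  · exact Eventually.of_forall fun t _ => (hlim t).tendsto_sum_nat

theorem continuousOn_neg_log_one_sub_norm {φ : ℂ → ℂ} (hφ : DifferentiableOn ℂ φ (ball 0 1))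
    (hφ_maps : MapsTo φ (ball 0 1) (ball 0 1)) :
    ContinuousOn (fun z => -Real.log (1 - ‖φ z‖)) (ball 0 1) :=
  ((continuousOn_const.sub hφ.continuousOn.norm).log fun _ hz =>
    (sub_pos.2 (mem_ball_zero_iff.1 (hφ_maps hz))).ne').neg

/-- If `M_w C_φ` is Hilbert–Schmidt for some `w ≠ 0`, then `log (1 / (1 - |φ|))` has bounded
circular means. -/
theorem exists_circleAverage_neg_log_le {φ : ℂ → ℂ} (hφ : DifferentiableOn ℂ φ (ball 0 1))
    (hφ_maps : MapsTo φ (ball 0 1) (ball 0 1))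
    {w₀ : HardySpace} {T₀ : HardySpace →L[ℂ] HardySpace}
    (hT₀ : IsWeightedComposition w₀ φ T₀) (hw₀ : w₀ ≠ 0)
    (hs : Summable fun n => ‖T₀ (HardySpace.monomialBasis n)‖ ^ 2) :
    ∃ B : ℝ, ∀ r ∈ Ico (1 / 2 : ℝ) 1,
      Real.circleAverage (fun z => -Real.log (1 - ‖φ z‖)) 0 r ≤ B := by
  obtain ⟨c, hc⟩ := exists_le_circleAverage_log_norm w₀.differentiableOn
  refine ⟨Real.log 2 + ∑' n, ‖T₀ (HardySpace.monomialBasis n)‖ ^ 2 - 2 * c, fun r hr => ?_⟩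
  have hr' : r ∈ Ioo (0 : ℝ) 1 := ⟨lt_of_lt_of_le (by norm_num) hr.1, hr.2⟩
  have hsph := sphere_subset_unitBall hr'
  have hw₀a := w₀.differentiableOn.analyticOnNhd isOpen_ball
  obtain ⟨x, hx, hx0⟩ : ∃ x ∈ ball (0 : ℂ) 1, w₀ x ≠ 0 := by
    by_contra! h
    exact hw₀ (HardySpace.ext_disk h)
  have hcod : {z | w₀ z ≠ 0} ∈ codiscreteWithin (sphere (0 : ℂ) |r|) :=
    codiscreteWithin_mono hsph (hw₀a.preimage_zero_mem_codiscreteWithin hx0 hx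
      (isConnected_ball zero_lt_one))
  have hG := ((continuousOn_sq_norm_div_one_sub_sq_norm hφ hφ_maps (w₀ := w₀)).mono
    hsph).circleIntegrable'
  have hL : CircleIntegrable (fun z => Real.log ‖w₀ z‖) 0 r :=
    (hw₀a.mono hsph).meromorphicOn.circleIntegrable_log_norm
  have hK : CircleIntegrable (fun _ : ℂ => Real.log 2) 0 r := circleIntegrable_const _ _ _
  have h2L : CircleIntegrable (fun z => 2 * Real.log ‖w₀ z‖) 0 r := hL.const_mul 2
  set R : ℂ → ℝ := fun z => Real.log 2 + ‖w₀ z‖ ^ 2 / (1 - ‖φ z‖ ^ 2) - 2 * Real.log ‖w₀ z‖ with hR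
  have hKG : CircleIntegrable (fun z => Real.log 2 + ‖w₀ z‖ ^ 2 / (1 - ‖φ z‖ ^ 2)) 0 r :=
    hK.add hG
  have hRi : CircleIntegrable R 0 r := hKG.sub h2L
  -- At zeros of `w₀` the convention `log 0 = 0` can break the pointwise bound by `R`. Changing `R`
  -- there leaves the average alone, as `w₀` is nonzero on a codiscrete subset of the circle.
  set S : ℂ → ℝ := fun z => if w₀ z = 0 then -Real.log (1 - ‖φ z‖) else R z with hS
  have hRS : R =ᶠ[codiscreteWithin (sphere (0 : ℂ) |r|)] S := by
    filter_upwards [hcod] with z hz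
    exact (if_neg hz).symm
  calc Real.circleAverage (fun z => -Real.log (1 - ‖φ z‖)) 0 r
      ≤ Real.circleAverage S 0 r := by
        refine Real.circleAverage_mono
          ((continuousOn_neg_log_one_sub_norm hφ hφ_maps).mono hsph).circleIntegrable'
          (hRi.congr_codiscreteWithin hRS) fun z hz => ?_
        simp only [hS]
        split_ifs with h
        · exact le_rfl
        · exact neg_log_one_sub_le (norm_pos_iff.2 h) (norm_nonneg _)
            (mem_ball_zero_iff.1 (hφ_maps (hsph hz)))
    _ = Real.circleAverage R 0 r :=
        (Real.circleAverage_congr_codiscreteWithin hRS hr'.1.ne').symm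
    _ = Real.log 2 + Real.circleAverage (fun z => ‖w₀ z‖ ^ 2 / (1 - ‖φ z‖ ^ 2)) 0 r -
          2 * Real.circleAverage (fun z => Real.log ‖w₀ z‖) 0 r := by
        rw [hR, Real.circleAverage_fun_sub hKG h2L, Real.circleAverage_fun_add hK hG,
          Real.circleAverage_const]
        congr 1
        exact Real.circleAverage_fun_smul (a := (2 : ℝ))
    _ ≤ _ := by
        have h1 := circleAverage_sq_norm_div_le hφ hφ_maps hT₀ hs hr'
        have h2 := hc r hr
        linarith

/-- An integrable function remains integrable after composition with some function of superlinear
growth. -/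
theorem exists_superlinear_integrable_comp {α : Type*} [MeasurableSpace α] {μ : Measure α}
    {h : α → ℝ} (hh : Integrable h μ) :
    ∃ Ψ : ℝ → ℝ, Integrable (fun t => Ψ (h t)) μ ∧
      ∀ N : ℕ, ∃ C : ℝ, ∀ x, N * x ≤ Ψ x + C := by
  have hmax (c : ℝ) (hc : 0 ≤ c) : ∀ t, ‖max (h t - c) 0‖ ≤ ‖h t‖ := fun t => by
    rw [Real.norm_of_nonneg (le_max_right _ _), Real.norm_eq_abs]
    exact max_le (by linarith [le_abs_self (h t)]) (abs_nonneg _)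
  have hmeas (c : ℝ) : AEStronglyMeasurable (fun t => max (h t - c) 0) μ :=
    ((hh.aestronglyMeasurable.aemeasurable.sub_const c).max
      aemeasurable_const).aestronglyMeasurable
  have hint (c : ℝ) (hc : 0 ≤ c) : Integrable (fun t => max (h t - c) 0) μ :=
    hh.mono (hmeas c) (Eventually.of_forall (hmax c hc))
  have htend : Tendsto (fun n : ℕ => ∫ t, max (h t - n) 0 ∂μ) atTop (𝓝 0) := by
    have h0 : ∫ _, (0 : ℝ) ∂μ = 0 := integral_zero α ℝ
    nth_rewrite 2 [← h0]
    refine tendsto_integral_of_dominated_convergence (fun t => ‖h t‖) (fun n => hmeas n) hh.norm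
      (fun n => Eventually.of_forall (hmax n n.cast_nonneg)) (Eventually.of_forall fun t => ?_)
    refine tendsto_const_nhds.congr' ?_
    filter_upwards [eventually_ge_atTop ⌈h t⌉₊] with n hn
    have : h t ≤ n := (Nat.le_ceil _).trans (by exact_mod_cast hn)
    rw [max_eq_right (by linarith)]
  -- The sum of the truncations `(x - c k)⁺` will be `Ψ`: `c k ≥ k` makes it finite at each `x`, the
  -- bound `2⁻ᵏ` makes `Ψ ∘ h` integrable, and its first `N` terms give slope `N`.
  have hex (k : ℕ) : ∃ n : ℕ, k ≤ n ∧ ∫ t, max (h t - n) 0 ∂μ ≤ (1 / 2) ^ k := by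
    have := (htend.eventually (ge_mem_nhds (show (0 : ℝ) < (1 / 2) ^ k by positivity)))
    obtain ⟨n, h1, h2⟩ := ((eventually_ge_atTop k).and this).exists
    exact ⟨n, h1, h2⟩
  choose c hck hcint using hex
  have hsum (x : ℝ) : Summable fun k : ℕ => max (x - c k) 0 := by
    refine summable_of_ne_finset_zero (s := Finset.range ⌈x⌉₊) fun k hk => ?_
    rw [Finset.mem_range, not_lt] at hk
    have h1 : x ≤ k := (Nat.le_ceil _).trans (by exact_mod_cast hk)
    have h2 : (k : ℝ) ≤ c k := by exact_mod_cast hck k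
    exact max_eq_right (by linarith)
  set Ψ : ℝ → ℝ := fun x => ∑' k : ℕ, max (x - c k) 0 with hΨ
  have hmono : Monotone Ψ := fun x y hxy =>
    (hsum x).tsum_le_tsum (fun k => max_le_max (by linarith) le_rfl) (hsum y)
  have hΨ0 (x : ℝ) : 0 ≤ Ψ x := tsum_nonneg fun k => le_max_right _ _
  refine ⟨Ψ, ⟨(hmono.measurable.comp_aemeasurable
    hh.aestronglyMeasurable.aemeasurable).aestronglyMeasurable, ?_⟩, fun N => ?_⟩
  · rw [hasFiniteIntegral_iff_ofReal (Eventually.of_forall fun t => hΨ0 (h t))]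
    have h1 (t : α) : ENNReal.ofReal (Ψ (h t)) =
        ∑' k : ℕ, ENNReal.ofReal (max (h t - c k) 0) :=
      ENNReal.ofReal_tsum_of_nonneg (fun k => le_max_right _ _) (hsum _)
    simp only [h1]
    rw [lintegral_tsum fun k => (hmeas _).aemeasurable.ennreal_ofReal]
    refine lt_of_le_of_lt (ENNReal.tsum_le_tsum fun k => ?_)
      summable_geometric_two.tsum_ofReal_lt_top
    rw [← ofReal_integral_eq_lintegral_ofReal (hint _ (Nat.cast_nonneg _))
      (Eventually.of_forall fun t => le_max_right _ _)]
    exact ENNReal.ofReal_le_ofReal (hcint k)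
  · refine ⟨∑ k ∈ Finset.range N, (c k : ℝ), fun x => ?_⟩
    have h1 : ∑ k ∈ Finset.range N, (x - c k) ≤ Ψ x :=
      (Finset.sum_le_sum fun k _ => le_max_left _ _).trans
        ((hsum x).sum_le_tsum _ fun k _ => le_max_right _ _)
    rw [Finset.sum_sub_distrib, Finset.sum_const, Finset.card_range, nsmul_eq_mul] at h1
    linarith

end Growth

/-! ### Radial limits along a sequence of radii -/

section RadialLimits

open MeasureTheory

namespace HardySpace

theorem exists_taylorCoeff_eq {c : ℕ → ℂ} (hc : Summable fun n => ‖c n‖ ^ 2) :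
    ∃ f : HardySpace, ∀ n, taylorCoeff f n = c n := by
  obtain ⟨f, hf⟩ := coeffMap_surjective ⟨c, memℓp_two_iff_summable.2 hc⟩
  exact ⟨f, fun n => by rw [← coeffMap_apply, hf]⟩

theorem summable_sq_norm_taylorCoeff (f : HardySpace) :
    Summable fun n => ‖taylorCoeff f n‖ ^ 2 :=
  (bddAbove_hardyMean_iff f.differentiableOn).1 f.bddAbove_hardyMean

/-- The squared norm `∑ |aₙ|² (1 - qⁿ)²` of the difference of `f` and its dilation by `q`. -/
noncomputable def dilationGap (f : HardySpace) (q : ℝ) : ℝ :=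
  ∑' n, ‖taylorCoeff f n‖ ^ 2 * (1 - q ^ n) ^ 2

theorem dilationGap_term_le (f : HardySpace) {q : ℝ} (hq : q ∈ Icc (0 : ℝ) 1) (n : ℕ) :
    ‖taylorCoeff f n‖ ^ 2 * (1 - q ^ n) ^ 2 ≤ ‖taylorCoeff f n‖ ^ 2 := by
  have h1 := pow_nonneg hq.1 n
  have h2 := pow_le_one₀ hq.1 hq.2 (n := n)
  exact mul_le_of_le_one_right (sq_nonneg _) (pow_le_one₀ (by linarith) (by linarith))

theorem summable_dilationGap (f : HardySpace) {q : ℝ} (hq : q ∈ Icc (0 : ℝ) 1) :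
    Summable fun n => ‖taylorCoeff f n‖ ^ 2 * (1 - q ^ n) ^ 2 :=
  Summable.of_nonneg_of_le (fun _ => by positivity) (f.dilationGap_term_le hq)
    f.summable_sq_norm_taylorCoeff

theorem dilationGap_anti (f : HardySpace) {s q : ℝ} (hs : 0 ≤ s) (hsq : s ≤ q) (hq : q ≤ 1) :
    f.dilationGap q ≤ f.dilationGap s := by
  refine (f.summable_dilationGap ⟨hs.trans hsq, hq⟩).tsum_le_tsum (fun n => ?_)
    (f.summable_dilationGap ⟨hs, hsq.trans hq⟩)
  have h1 := pow_le_pow_left₀ hs hsq n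
  have h2 := pow_le_one₀ (hs.trans hsq) hq (n := n)
  exact mul_le_mul_of_nonneg_left (pow_le_pow_left₀ (by linarith) (by linarith) 2) (sq_nonneg _)

theorem tendsto_dilationGap (f : HardySpace) : Tendsto f.dilationGap (𝓝[<] 1) (𝓝 0) := by
  have h : Tendsto f.dilationGap (𝓝[<] 1)
      (𝓝 (∑' n, ‖taylorCoeff f n‖ ^ 2 * (1 - (1 : ℝ) ^ n) ^ 2)) := by
    refine tendsto_tsum_of_dominated_convergence f.summable_sq_norm_taylorCoeff (fun n => ?_) ?_
    · refine Tendsto.mono_left (Continuous.tendsto ?_ 1) nhdsWithin_le_nhds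
      fun_prop
    · filter_upwards [Ioo_mem_nhdsLT (zero_lt_one' ℝ)] with q hq n
      rw [Real.norm_of_nonneg (by positivity)]
      exact f.dilationGap_term_le ⟨hq.1.le, hq.2.le⟩ n
  simpa using h

/-- The function `f(z) - f(qz)` lies in `H²` with coefficients `aₙ (1 - qⁿ)`, so its means are
bounded by its squared norm. -/
theorem circleAverage_sq_norm_sub_dilation_le (f : HardySpace) {q r : ℝ} (hq : q ∈ Icc (0 : ℝ) 1)
    (hr : r ∈ Ioo (0 : ℝ) 1) :
    Real.circleAverage (fun z => ‖f z - f (q * z)‖ ^ 2) 0 r ≤ f.dilationGap q := by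
  have hterm (n : ℕ) : ‖taylorCoeff f n * (1 - (q : ℂ) ^ n)‖ ^ 2 =
      ‖taylorCoeff f n‖ ^ 2 * (1 - q ^ n) ^ 2 := by
    have : (1 - (q : ℂ) ^ n) = ((1 - q ^ n : ℝ) : ℂ) := by push_cast; rfl
    rw [norm_mul, mul_pow, this, Complex.norm_real, Real.norm_eq_abs, sq_abs]
  obtain ⟨g, hg⟩ := exists_taylorCoeff_eq (c := fun n => taylorCoeff f n * (1 - (q : ℂ) ^ n))
    (by simpa only [hterm] using f.summable_dilationGap hq)
  have hgf {z : ℂ} (hz : z ∈ ball (0 : ℂ) 1) : g z = f z - f (q * z) := by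
    have hqz : (q * z : ℂ) ∈ ball (0 : ℂ) 1 := by
      rw [mem_ball_zero_iff] at hz ⊢
      rw [norm_mul, Complex.norm_real, Real.norm_of_nonneg hq.1]
      exact (mul_le_of_le_one_left (norm_nonneg z) hq.2).trans_lt hz
    refine (hasSum_taylorCoeff g.differentiableOn hz).unique ?_
    have he : (fun n => taylorCoeff g n * z ^ n) =
        fun n => taylorCoeff f n * z ^ n - taylorCoeff f n * (q * z) ^ n := by
      funext n
      rw [hg, mul_pow]
      ring
    rw [he]
    exact (hasSum_taylorCoeff f.differentiableOn hz).sub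
      (hasSum_taylorCoeff f.differentiableOn hqz)
  have h := g.isLUB_hardyMean.1 (mem_image_of_mem _ hr)
  rw [norm_sq_eq_tsum, hardyMean_eq_circleAverage] at h
  simp only [hg, hterm] at h
  refine le_trans (le_of_eq (Real.circleAverage_congr_sphere fun z hz => ?_)) h
  rw [hgf (sphere_subset_unitBall hr hz)]

theorem continuous_comp_circleMap (f : HardySpace) {r : ℝ} (hr : r ∈ Ioo (0 : ℝ) 1) :
    Continuous fun t => f (circleMap 0 r t) :=
  f.differentiableOn.continuousOn.comp_continuous (continuous_circleMap 0 r) fun t =>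
    sphere_subset_unitBall hr (circleMap_mem_sphere' 0 r t)

/-- The circle of radius `s` is the dilate by `q = s / r` of the one of radius `r`. As `s ≤ q`,
monotonicity of the gap gives a bound in terms of the smaller radius alone. -/
theorem integral_sq_norm_sub_le (f : HardySpace) {s r : ℝ} (hs : 0 < s) (hsr : s ≤ r)
    (hr : r < 1) :
    ∫ t in Ioc 0 (2 * Real.pi), ‖f (circleMap 0 r t) - f (circleMap 0 s t)‖ ^ 2 ≤
      2 * Real.pi * f.dilationGap s := by
  have hr0 : 0 < r := hs.trans_le hsr
  have hsq : s ≤ s / r := by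
    rw [le_div_iff₀ hr0]
    nlinarith
  have hq1 : s / r ≤ 1 := (div_le_one hr0).2 hsr
  have h := (f.circleAverage_sq_norm_sub_dilation_le ⟨hs.le.trans hsq, hq1⟩ ⟨hr0, hr⟩).trans
    (f.dilationGap_anti hs.le hsq hq1)
  rw [Real.circleAverage_def, smul_eq_mul, inv_mul_le_iff₀ Real.two_pi_pos,
    intervalIntegral.integral_of_le Real.two_pi_pos.le] at h
  have he (t : ℝ) : ((s / r : ℝ) : ℂ) * circleMap 0 r t = circleMap 0 s t := by
    have : (r : ℂ) ≠ 0 := by exact_mod_cast hr0.ne'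
    simp only [circleMap_zero]
    push_cast
    field_simp
  simpa only [he] using h

theorem eLpNorm_sub_le (f : HardySpace) {s r : ℝ} (hs : 0 < s) (hsr : s ≤ r) (hr : r < 1) :
    eLpNorm ((fun t => f (circleMap 0 r t)) - fun t => f (circleMap 0 s t)) 2
      (volume.restrict (Ioc 0 (2 * Real.pi))) ≤
      ENNReal.ofReal ((2 * Real.pi * f.dilationGap s) ^ (2⁻¹ : ℝ)) := by
  have hcont : Continuous ((fun t => f (circleMap 0 r t)) - fun t => f (circleMap 0 s t)) :=
    (f.continuous_comp_circleMap ⟨hs.trans_le hsr, hr⟩).sub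
      (f.continuous_comp_circleMap ⟨hs, hsr.trans_lt hr⟩)
  have hmem : MemLp ((fun t => f (circleMap 0 r t)) - fun t => f (circleMap 0 s t)) 2
      (volume.restrict (Ioc 0 (2 * Real.pi))) := by
    rw [memLp_two_iff_integrable_sq_norm hcont.aestronglyMeasurable]
    exact ((hcont.norm.pow 2).integrableOn_Icc (a := 0) (b := 2 * Real.pi)).mono_set
      Ioc_subset_Icc_self
  rw [hmem.eLpNorm_eq_integral_rpow_norm two_ne_zero ENNReal.ofNat_ne_top]
  refine ENNReal.ofReal_le_ofReal ?_
  simp only [ENNReal.toReal_ofNat, Real.rpow_ofNat, Pi.sub_apply]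
  exact Real.rpow_le_rpow (integral_nonneg fun t => sq_nonneg _)
    (f.integral_sq_norm_sub_le hs hsr hr) (by norm_num)

/-- Along some sequence of radii tending to `1`, a function in `H²` has radial limits almost
everywhere. -/
theorem exists_ae_tendsto_radial (f : HardySpace) :
    ∃ r : ℕ → ℝ, (∀ n, r n ∈ Ico (1 / 2 : ℝ) 1) ∧ Tendsto r atTop (𝓝 1) ∧
      ∀ᵐ t ∂volume.restrict (Ioc 0 (2 * Real.pi)),
        ∃ l, Tendsto (fun n => f (circleMap 0 (r n) t)) atTop (𝓝 l) := by
  -- The radii are chosen so that the `L²` distances are at most `2⁻ⁿ`. Summability of these bounds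
  -- gives almost everywhere convergence without passing to a further subsequence.
  have hex (n : ℕ) : ∃ q : ℝ, q ∈ Ico (1 / 2 : ℝ) 1 ∧ 1 - 1 / (n + 1 : ℝ) < q ∧
      2 * Real.pi * f.dilationGap q ≤ ((1 / 2) ^ n) ^ 2 := by
    have h1 : Tendsto (fun q => 2 * Real.pi * f.dilationGap q) (𝓝[<] 1) (𝓝 0) := by
      simpa using f.tendsto_dilationGap.const_mul (2 * Real.pi)
    have h2 := h1.eventually (ge_mem_nhds (show (0 : ℝ) < ((1 / 2) ^ n) ^ 2 by positivity))
    have h3 : (1 - 1 / (n + 1 : ℝ)) < 1 := sub_lt_self _ (by positivity)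
    have h4 : ∀ᶠ q in 𝓝[<] (1 : ℝ), q ∈ Ico (1 / 2 : ℝ) 1 := Ico_mem_nhdsLT (by norm_num)
    have h5 : ∀ᶠ q in 𝓝[<] (1 : ℝ), q ∈ Ioo (1 - 1 / (n + 1 : ℝ)) 1 := Ioo_mem_nhdsLT h3
    obtain ⟨q, hq1, hq2, hq3⟩ := (h4.and (h5.and h2)).exists
    exact ⟨q, hq1, hq2.1, hq3⟩
  choose r hr hr1 hgap using hex
  have hr0 (n : ℕ) : 0 < r n := lt_of_lt_of_le (by norm_num) (hr n).1
  refine ⟨r, hr, ?_, ?_⟩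
  · refine tendsto_of_tendsto_of_tendsto_of_le_of_le ?_ tendsto_const_nhds (fun n => (hr1 n).le)
      fun n => (hr n).2.le
    simpa using (tendsto_const_nhds (x := (1 : ℝ))).sub
      (tendsto_one_div_add_atTop_nhds_zero_nat (𝕜 := ℝ))
  · have hbound (N n m : ℕ) (hn : N ≤ n) (hnm : r n ≤ r m) :
        eLpNorm ((fun t => f (circleMap 0 (r m) t)) - fun t => f (circleMap 0 (r n) t)) 2
          (volume.restrict (Ioc 0 (2 * Real.pi))) < ENNReal.ofReal (2 * (1 / 2) ^ N) := by
      refine (f.eLpNorm_sub_le (hr0 n) hnm (hr m).2).trans_lt ?_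
      refine (ENNReal.ofReal_lt_ofReal_iff (by positivity)).2 ?_
      have h1 : (2 * Real.pi * f.dilationGap (r n)) ^ (2⁻¹ : ℝ) ≤ (1 / 2) ^ n := by
        rw [← one_div, ← Real.sqrt_eq_rpow]
        exact Real.sqrt_le_iff.2 ⟨by positivity, hgap n⟩
      have h2 : (1 / 2 : ℝ) ^ n ≤ (1 / 2) ^ N :=
        pow_le_pow_of_le_one (by norm_num) (by norm_num) hn
      have h3 : (0 : ℝ) < (1 / 2) ^ N := by positivity
      linarith
    refine Lp.ae_tendsto_of_cauchy_eLpNorm (p := 2)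
      (f := fun n t => f (circleMap 0 (r n) t)) (B := fun N => ENNReal.ofReal (2 * (1 / 2) ^ N))
      (fun n => (f.continuous_comp_circleMap ⟨hr0 n, (hr n).2⟩).aestronglyMeasurable)
      (by norm_num) (summable_geometric_two.mul_left 2).tsum_ofReal_ne_top
      fun N n m hn hm => ?_
    rcases le_total (r n) (r m) with h | h
    · rw [eLpNorm_sub_comm]
      exact hbound N n m hn h
    · exact hbound N m n hm h

end HardySpace

/-- Radial limits of an analytic self-map of the disk whose functions `log (1 / (1 - |φ|))` have
bounded circular means. -/
theorem exists_boundary_function {φ : ℂ → ℂ} (hφ : DifferentiableOn ℂ φ (ball 0 1))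
    (hφ_maps : MapsTo φ (ball 0 1) (ball 0 1)) {B : ℝ}
    (hB : ∀ r ∈ Ico (1 / 2 : ℝ) 1,
      Real.circleAverage (fun z => -Real.log (1 - ‖φ z‖)) 0 r ≤ B) :
    ∃ (r : ℕ → ℝ) (ψ : ℂ → ℂ), (∀ n, r n ∈ Ioo (0 : ℝ) 1) ∧ Tendsto r atTop (𝓝 1) ∧
      (∀ᵐ t ∂volume.restrict (Ioc 0 (2 * Real.pi)),
        Tendsto (fun n => φ (r n * circleMap 0 1 t)) atTop (𝓝 (ψ (circleMap 0 1 t)))) ∧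
      (∀ᵐ t ∂volume.restrict (Ioc 0 (2 * Real.pi)), ‖ψ (circleMap 0 1 t)‖ < 1) ∧
      CircleIntegrable ψ 0 1 ∧ CircleIntegrable (fun z => -Real.log (1 - ‖ψ z‖)) 0 1 := by
  have hball : ∀ z ∈ ball (0 : ℂ) 1, ‖φ z‖ < 1 := fun z hz => mem_ball_zero_iff.1 (hφ_maps hz)
  let f := HardySpace.ofBounded φ hφ ⟨1, fun z hz => (hball z hz).le⟩
  obtain ⟨r, hr, hr1, hlim⟩ := f.exists_ae_tendsto_radial
  have hr' (n : ℕ) : r n ∈ Ioo (0 : ℝ) 1 := ⟨lt_of_lt_of_le (by norm_num) (hr n).1, (hr n).2⟩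
  have hmem (n : ℕ) (t : ℝ) : circleMap 0 (r n) t ∈ ball (0 : ℂ) 1 :=
    sphere_subset_unitBall (hr' n) (circleMap_mem_sphere' 0 (r n) t)
  have hcm (n : ℕ) (t : ℝ) : (r n : ℂ) * circleMap 0 1 t = circleMap 0 (r n) t := by
    simp [circleMap_zero]
  -- Where no limit exists this value is arbitrary; only almost every boundary point matters.
  set ψ : ℂ → ℂ := fun ζ => limUnder atTop fun n => φ (r n * ζ) with hψ
  set μ := volume.restrict (Ioc 0 (2 * Real.pi)) with hμ
  have htend : ∀ᵐ t ∂μ,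
      Tendsto (fun n => φ (r n * circleMap 0 1 t)) atTop (𝓝 (ψ (circleMap 0 1 t))) := by
    filter_upwards [hlim] with t ht
    refine tendsto_nhds_limUnder ?_
    obtain ⟨l, hl⟩ := ht
    refine ⟨l, hl.congr fun n => ?_⟩
    rw [hcm]
    exact HardySpace.ofBounded_apply _ _ _ (hmem n t)
  have hcont (n : ℕ) : Continuous fun t => φ (r n * circleMap 0 1 t) := by
    simp only [hcm]
    exact hφ.continuousOn.comp_continuous (continuous_circleMap 0 _) (hmem n)
  have hlt (n : ℕ) (t : ℝ) : ‖φ (r n * circleMap 0 1 t)‖ < 1 := by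
    rw [hcm]
    exact hball _ (hmem n t)
  set h : ℕ → ℝ → ℝ := fun n t => -Real.log (1 - ‖φ (r n * circleMap 0 1 t)‖) with hh
  have hh0 (n : ℕ) (t : ℝ) : 0 ≤ h n t := neg_nonneg.2
    (Real.log_nonpos (sub_nonneg.2 (hlt n t).le) (sub_le_self _ (norm_nonneg _)))
  have hhcont (n : ℕ) : Continuous (h n) :=
    ((continuous_const.sub (hcont n).norm).log fun t => (sub_pos.2 (hlt n t)).ne').neg
  have hhint (n : ℕ) : Integrable (h n) μ :=
    ((hhcont n).integrableOn_Icc (a := 0) (b := 2 * Real.pi)).mono_set Ioc_subset_Icc_self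
  have hbound (n : ℕ) : ∫⁻ t, ENNReal.ofReal (h n t) ∂μ ≤ ENNReal.ofReal (2 * Real.pi * B) := by
    rw [← ofReal_integral_eq_lintegral_ofReal (hhint n) (Eventually.of_forall (hh0 n))]
    refine ENNReal.ofReal_le_ofReal ?_
    have h1 := hB (r n) (hr n)
    rw [Real.circleAverage_def, smul_eq_mul, inv_mul_le_iff₀ Real.two_pi_pos,
      intervalIntegral.integral_of_le Real.two_pi_pos.le] at h1
    simpa only [hh, hcm] using h1
  have hfatou : ∫⁻ t, liminf (fun n => ENNReal.ofReal (h n t)) atTop ∂μ ≤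
      ENNReal.ofReal (2 * Real.pi * B) := by
    refine (lintegral_liminf_le fun n => (hhcont n).measurable.ennreal_ofReal).trans ?_
    refine liminf_le_of_le (by isBoundedDefault) fun b hb => ?_
    obtain ⟨n, hn⟩ := hb.exists
    exact hn.trans (hbound n)
  have hfin : ∀ᵐ t ∂μ, liminf (fun n => ENNReal.ofReal (h n t)) atTop < ⊤ :=
    ae_lt_top (Measurable.liminf fun n => (hhcont n).measurable.ennreal_ofReal)
      (ne_top_of_le_ne_top ENNReal.ofReal_ne_top hfatou)
  -- Where `|ψ| = 1`, the functions `h n` tend to infinity, which the finite `liminf` from Fatou's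
  -- lemma excludes.
  have hψlt : ∀ᵐ t ∂μ, ‖ψ (circleMap 0 1 t)‖ < 1 := by
    filter_upwards [htend, hfin] with t ht hft
    refine lt_of_le_of_ne (le_of_tendsto ht.norm (Eventually.of_forall fun n => (hlt n t).le))
      fun heq => hft.ne ?_
    have h1 : Tendsto (fun n => 1 - ‖φ (r n * circleMap 0 1 t)‖) atTop (𝓝[>] 0) := by
      refine tendsto_nhdsWithin_iff.2 ⟨?_, Eventually.of_forall fun n => sub_pos.2 (hlt n t)⟩
      have := ht.norm.const_sub 1
      rwa [heq, sub_self] at this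
    have h2 : Tendsto (fun n => h n t) atTop atTop :=
      tendsto_neg_atBot_atTop.comp (Real.tendsto_log_nhdsGT_zero.comp h1)
    exact (ENNReal.tendsto_ofReal_atTop.comp h2).liminf_eq
  have hψm : AEStronglyMeasurable (fun t => ψ (circleMap 0 1 t)) μ :=
    aestronglyMeasurable_of_tendsto_ae atTop (fun n => (hcont n).aestronglyMeasurable) htend
  refine ⟨r, ψ, hr', hr1, htend, hψlt, ?_, ?_⟩
  · rw [CircleIntegrable, intervalIntegrable_iff_integrableOn_Ioc_of_le Real.two_pi_pos.le]
    exact Integrable.of_bound hψm 1 (hψlt.mono fun t ht => ht.le)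
  · rw [CircleIntegrable, intervalIntegrable_iff_integrableOn_Ioc_of_le Real.two_pi_pos.le]
    have hm : AEStronglyMeasurable (fun t => -Real.log (1 - ‖ψ (circleMap 0 1 t)‖)) μ :=
      (Real.measurable_log.comp_aemeasurable
        (hψm.norm.aemeasurable.const_sub 1)).neg.aestronglyMeasurable
    refine ⟨hm, ?_⟩
    have hnn : 0 ≤ᵐ[μ] fun t => -Real.log (1 - ‖ψ (circleMap 0 1 t)‖) := by
      filter_upwards [hψlt] with t ht
      exact neg_nonneg.2
        (Real.log_nonpos (sub_nonneg.2 ht.le) (sub_le_self _ (norm_nonneg _)))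
    rw [hasFiniteIntegral_iff_ofReal hnn]
    refine lt_of_le_of_lt (le_of_eq_of_le (lintegral_congr_ae ?_) hfatou) ENNReal.ofReal_lt_top
    filter_upwards [htend, hψlt] with t ht hlt'
    refine (Tendsto.liminf_eq ?_).symm
    refine ENNReal.tendsto_ofReal (Tendsto.neg ?_)
    exact (Real.continuousAt_log (sub_pos.2 hlt').ne').tendsto.comp (ht.norm.const_sub 1)

end RadialLimits

/-! ### The weight as an outer function -/

section OuterFunction

open MeasureTheory

theorem re_herglotzRieszKernel_nonneg {z ζ : ℂ} (hz : z ∈ ball (0 : ℂ) 1)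
    (hζ : ζ ∈ sphere (0 : ℂ) 1) : 0 ≤ (herglotzRieszKernel 0 z ζ).re := by
  refine le_trans ?_ (le_re_herglotzRieszKernel hζ hz)
  rw [mem_ball, dist_eq_norm] at hz
  exact div_nonneg (sub_nonneg.2 hz.le) (by positivity)

theorem continuous_re_herglotzRieszKernel_circleMap {z : ℂ} (hz : z ∈ ball (0 : ℂ) 1) :
    Continuous fun t => (herglotzRieszKernel 0 z (circleMap 0 1 t)).re :=
  Complex.continuous_re.comp ((continuousOn_herglotzRieszKernel_sphere hz).comp_continuous
    (continuous_circleMap 0 1) fun t => circleMap_mem_sphere' 0 1 t)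

theorem circleAverage_re_herglotzRieszKernel {z : ℂ} (hz : z ∈ ball (0 : ℂ) 1) :
    Real.circleAverage (fun ζ => (herglotzRieszKernel 0 z ζ).re) 0 1 = 1 := by
  have h := (diffContOnCl_const (s := ball (0 : ℂ) 1)
    (c := (1 : ℂ))).circleAverage_re_herglotzRieszKernel_smul hz
  have hi : CircleIntegrable ((Complex.re ∘ herglotzRieszKernel 0 z) • fun _ => (1 : ℂ)) 0 1 :=
    ((continuous_re_herglotzRieszKernel_circleMap hz).smul continuous_const).intervalIntegrable _ _
  have h2 := Complex.reCLM.circleAverage_comp_comm hi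
  rw [h] at h2
  simpa [Function.comp_def] using h2

/-- Subharmonicity of `|φ|` expressed with the boundary function of `φ`. -/
theorem norm_le_circleAverage_re_herglotzRieszKernel_mul_norm {φ ψ : ℂ → ℂ}
    (hφ : DifferentiableOn ℂ φ (ball 0 1)) (hφ_maps : MapsTo φ (ball 0 1) (ball 0 1))
    {r : ℕ → ℝ} (hr : ∀ n, r n ∈ Ioo (0 : ℝ) 1) (hr1 : Tendsto r atTop (𝓝 1))
    (hψ : ∀ᵐ t ∂volume.restrict (Ioc 0 (2 * Real.pi)),
        Tendsto (fun n => φ (r n * circleMap 0 1 t)) atTop (𝓝 (ψ (circleMap 0 1 t))))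
    {z : ℂ} (hz : z ∈ ball (0 : ℂ) 1) :
    ‖φ z‖ ≤ Real.circleAverage (fun ζ => (herglotzRieszKernel 0 z ζ).re * ‖ψ ζ‖) 0 1 := by
  have hP := continuous_re_herglotzRieszKernel_circleMap hz
  have hscale (n : ℕ) {ζ : ℂ} (hζ : ζ ∈ closedBall (0 : ℂ) 1) : (r n * ζ : ℂ) ∈ ball (0 : ℂ) 1 := by
    rw [mem_closedBall_zero_iff] at hζ
    rw [mem_ball_zero_iff, norm_mul, Complex.norm_real, Real.norm_of_nonneg (hr n).1.le]
    exact (mul_le_of_le_one_right (hr n).1.le hζ).trans_lt (hr n).2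
  -- The dilates `φ (r n * ζ)` are differentiable on the closed disk, so Poisson's formula holds for
  -- them; it passes to `ψ` by dominated convergence, as `|φ| < 1`.
  have hpoisson (n : ℕ) : Real.circleAverage
      ((Complex.re ∘ herglotzRieszKernel 0 z) • fun ζ => φ (r n * ζ)) 0 1 = φ (r n * z) := by
    refine DiffContOnCl.circleAverage_re_herglotzRieszKernel_smul ?_ hz
    refine DifferentiableOn.diffContOnCl ?_
    rw [closure_ball _ one_ne_zero]
    exact hφ.comp (differentiableOn_id.const_mul _) fun ζ hζ => hscale n hζ
  have hlim1 : Tendsto (fun n => φ (r n * z)) atTop (𝓝 (φ z)) := by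
    have h1 : Tendsto (fun n => (r n * z : ℂ)) atTop (𝓝 z) := by
      simpa using ((Complex.continuous_ofReal.tendsto 1).comp hr1).mul_const z
    exact (hφ.continuousOn.continuousAt (isOpen_ball.mem_nhds hz)).tendsto.comp h1
  have hlim2 : Tendsto (fun n => φ (r n * z)) atTop
      (𝓝 (Real.circleAverage ((Complex.re ∘ herglotzRieszKernel 0 z) • ψ) 0 1)) := by
    simp only [← hpoisson, Real.circleAverage_def]
    refine Tendsto.const_smul ?_ _
    refine intervalIntegral.tendsto_integral_filter_of_dominated_convergence
      (fun t => |(herglotzRieszKernel 0 z (circleMap 0 1 t)).re|) ?_ ?_ ?_ ?_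
    · refine Eventually.of_forall fun n => Continuous.aestronglyMeasurable ?_
      refine hP.smul (hφ.continuousOn.comp_continuous
        (continuous_const.mul (continuous_circleMap 0 1)) fun t => hscale n ?_)
      exact circleMap_mem_closedBall 0 zero_le_one t
    · refine Eventually.of_forall fun n => Eventually.of_forall fun t _ => ?_
      rw [Pi.smul_apply', norm_smul, Function.comp_apply, Real.norm_eq_abs]
      exact mul_le_of_le_one_right (abs_nonneg _) (mem_ball_zero_iff.1 (hφ_maps
        (hscale n (circleMap_mem_closedBall 0 zero_le_one t)))).le
    · exact hP.abs.intervalIntegrable _ _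
    · rw [uIoc_of_le Real.two_pi_pos.le]
      filter_upwards [(ae_restrict_iff' measurableSet_Ioc).1 hψ] with t ht hmem
      exact (ht hmem).const_smul (herglotzRieszKernel 0 z (circleMap 0 1 t)).re
  rw [tendsto_nhds_unique hlim1 hlim2, Real.circleAverage_def, Real.circleAverage_def, norm_smul,
    Real.norm_of_nonneg (inv_nonneg.2 Real.two_pi_pos.le), smul_eq_mul]
  refine mul_le_mul_of_nonneg_left ?_ (inv_nonneg.2 Real.two_pi_pos.le)
  refine (intervalIntegral.norm_integral_le_integral_norm Real.two_pi_pos.le).trans (le_of_eq ?_)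
  refine intervalIntegral.integral_congr fun t _ => ?_
  simp only [Pi.smul_apply', norm_smul, Function.comp_apply]
  rw [Real.norm_of_nonneg (re_herglotzRieszKernel_nonneg hz
    (circleMap_mem_sphere 0 zero_le_one t))]

/-- A convex function lies above its tangent line at `a`. -/
theorem neg_log_one_sub_add_div_le {a s : ℝ} (ha : a < 1) (hs : s < 1) :
    -Real.log (1 - a) + (s - a) / (1 - a) ≤ -Real.log (1 - s) := by
  have ha' := sub_pos.2 ha
  have hs' := sub_pos.2 hs
  have h := Real.log_le_sub_one_of_pos (div_pos hs' ha')
  rw [Real.log_div hs'.ne' ha'.ne'] at h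
  have e : (1 - s) / (1 - a) - 1 = -((s - a) / (1 - a)) := by
    field_simp
    ring
  rw [e] at h
  linarith

/-- If the functions `log (1 / (1 - |φ|))` have bounded circular means, then there is a zero-free
analytic function decaying faster than every power of `1 - |φ|`. -/
theorem exists_weight_le_one_sub_norm_pow {φ : ℂ → ℂ} (hφ : DifferentiableOn ℂ φ (ball 0 1))
    (hφ_maps : MapsTo φ (ball 0 1) (ball 0 1)) {B : ℝ}
    (hB : ∀ r ∈ Ico (1 / 2 : ℝ) 1,
      Real.circleAverage (fun z => -Real.log (1 - ‖φ z‖)) 0 r ≤ B) :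
    ∃ w : ℂ → ℂ, DifferentiableOn ℂ w (ball 0 1) ∧ (∀ z, w z ≠ 0) ∧
      ∀ N : ℕ, ∃ C : ℝ, ∀ z ∈ ball (0 : ℂ) 1, ‖w z‖ ≤ C * (1 - ‖φ z‖) ^ N := by
  obtain ⟨r, ψ, hr, hr1, hlim, hψlt, hψi, hhi⟩ := exists_boundary_function hφ hφ_maps hB
  have hhi' := hhi
  rw [CircleIntegrable, intervalIntegrable_iff_integrableOn_Ioc_of_le Real.two_pi_pos.le] at hhi'
  obtain ⟨Ψ, hΨi, hΨ⟩ := exists_superlinear_integrable_comp hhi'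
  set u : ℂ → ℝ := fun ζ => Ψ (-Real.log (1 - ‖ψ ζ‖)) with hu
  have hui : CircleIntegrable u 0 1 := by
    rw [CircleIntegrable, intervalIntegrable_iff_integrableOn_Ioc_of_le Real.two_pi_pos.le]
    exact hΨi
  have huc : CircleIntegrable (fun ζ => (u ζ : ℂ)) 0 1 :=
    ⟨hui.1.ofReal, hui.2.ofReal⟩
  refine ⟨fun z => Complex.exp
    (-Real.circleAverage (fun ζ => herglotzRieszKernel 0 z ζ • (u ζ : ℂ)) 0 1),
    (differentiableOn_circleAverage_herglotzRieszKernel_smul huc).neg.cexp,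
    fun z => Complex.exp_ne_zero _, fun N => ?_⟩
  obtain ⟨C, hC⟩ := hΨ N
  refine ⟨Real.exp C, fun z hz => ?_⟩
  have hz1 : ‖φ z‖ < 1 := mem_ball_zero_iff.1 (hφ_maps hz)
  have hz1' := sub_pos.2 hz1
  have hP := continuous_re_herglotzRieszKernel_circleMap hz
  have hPi : CircleIntegrable (fun ζ => (herglotzRieszKernel 0 z ζ).re) 0 1 :=
    hP.intervalIntegrable _ _
  have hPc : ContinuousOn (fun ζ => (herglotzRieszKernel 0 z ζ).re) (sphere 0 |1|) :=
    Complex.continuous_re.comp_continuousOn (continuousOn_herglotzRieszKernel_sphere hz)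
  have hPψ : CircleIntegrable (fun ζ => (herglotzRieszKernel 0 z ζ).re * ‖ψ ζ‖) 0 1 :=
    hψi.norm.continuousOn_mul hP.continuousOn
  have hPu : CircleIntegrable (fun ζ => (herglotzRieszKernel 0 z ζ).re * u ζ) 0 1 :=
    hui.continuousOn_mul hPc
  -- The line `α + β s` is the tangent to `-N log (1 - s) - C` at `s = |φ z|`. Integrated against
  -- the Poisson kernel it proves Jensen's inequality: `β ≥ 0` allows the use of `|φ z| ≤
  -- P[|ψ|](z)`, and the line's value at `|φ z|` is the required bound.
  set β : ℝ := N / (1 - ‖φ z‖) with hβ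
  set α : ℝ := N * -Real.log (1 - ‖φ z‖) - C - β * ‖φ z‖ with hα
  have hβ0 : 0 ≤ β := by positivity
  have hαP : CircleIntegrable (fun ζ => α * (herglotzRieszKernel 0 z ζ).re) 0 1 :=
    hPi.const_mul α
  have hβP : CircleIntegrable (fun ζ => β * ((herglotzRieszKernel 0 z ζ).re * ‖ψ ζ‖)) 0 1 :=
    hPψ.const_mul β
  have hptw {s : ℝ} (hs : s < 1) : α + β * s ≤ Ψ (-Real.log (1 - s)) := by
    have h1 := hC (-Real.log (1 - s))
    have h2 := mul_le_mul_of_nonneg_left (neg_log_one_sub_add_div_le hz1 hs) N.cast_nonneg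
    have h3 : (N : ℝ) * ((s - ‖φ z‖) / (1 - ‖φ z‖)) = β * s - β * ‖φ z‖ := by
      rw [hβ]
      ring
    rw [mul_add, h3] at h2
    linarith
  have hmono : Real.circleAverage (fun ζ => α * (herglotzRieszKernel 0 z ζ).re +
      β * ((herglotzRieszKernel 0 z ζ).re * ‖ψ ζ‖)) 0 1 ≤
      Real.circleAverage (fun ζ => (herglotzRieszKernel 0 z ζ).re * u ζ) 0 1 := by
    rw [Real.circleAverage_def, Real.circleAverage_def, smul_eq_mul, smul_eq_mul]
    refine mul_le_mul_of_nonneg_left ?_ (inv_nonneg.2 Real.two_pi_pos.le)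
    rw [intervalIntegral.integral_of_le Real.two_pi_pos.le,
      intervalIntegral.integral_of_le Real.two_pi_pos.le]
    have hl := hαP.add hβP
    rw [CircleIntegrable, intervalIntegrable_iff_integrableOn_Ioc_of_le Real.two_pi_pos.le] at hl
    have hl' := hPu
    rw [CircleIntegrable, intervalIntegrable_iff_integrableOn_Ioc_of_le Real.two_pi_pos.le] at hl'
    refine integral_mono_ae hl hl' ?_
    filter_upwards [hψlt] with t ht
    have hnn := re_herglotzRieszKernel_nonneg hz (circleMap_mem_sphere 0 zero_le_one t)
    have := mul_le_mul_of_nonneg_left (hptw ht) hnn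
    simp only [hu]
    linarith
  have hre : Real.circleAverage (fun ζ => (herglotzRieszKernel 0 z ζ).re * u ζ) 0 1 =
      (Real.circleAverage (fun ζ => herglotzRieszKernel 0 z ζ • (u ζ : ℂ)) 0 1).re :=
    (re_circleAverage_herglotzRieszKernel_smul hui hz).symm
  have hαavg : Real.circleAverage (fun ζ => α * (herglotzRieszKernel 0 z ζ).re) 0 1 = α := by
    have h : Real.circleAverage (fun ζ => α * (herglotzRieszKernel 0 z ζ).re) 0 1 =
        α * Real.circleAverage (fun ζ => (herglotzRieszKernel 0 z ζ).re) 0 1 :=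
      Real.circleAverage_fun_smul (a := α)
    rw [h, circleAverage_re_herglotzRieszKernel hz, mul_one]
  have hβavg : β * ‖φ z‖ ≤
      Real.circleAverage (fun ζ => β * ((herglotzRieszKernel 0 z ζ).re * ‖ψ ζ‖)) 0 1 := by
    have h : Real.circleAverage (fun ζ => β * ((herglotzRieszKernel 0 z ζ).re * ‖ψ ζ‖)) 0 1 =
        β * Real.circleAverage (fun ζ => (herglotzRieszKernel 0 z ζ).re * ‖ψ ζ‖) 0 1 :=
      Real.circleAverage_fun_smul (a := β)
    rw [h]
    exact mul_le_mul_of_nonneg_left (norm_le_circleAverage_re_herglotzRieszKernel_mul_norm hφ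
      hφ_maps hr hr1 hlim hz) hβ0
  rw [Real.circleAverage_fun_add hαP hβP, hαavg, hre] at hmono
  rw [Complex.norm_exp, Complex.neg_re]
  calc Real.exp (-(Real.circleAverage (fun ζ => herglotzRieszKernel 0 z ζ • (u ζ : ℂ)) 0 1).re)
      ≤ Real.exp (C + N * Real.log (1 - ‖φ z‖)) := by
        refine Real.exp_le_exp.2 ?_
        linarith
    _ = Real.exp C * (1 - ‖φ z‖) ^ N := by
        rw [Real.exp_add, Real.exp_nat_mul, Real.exp_log hz1']

end OuterFunction

/-! ### The main theorem -/

theorem mainTheorem8 (φ : ℂ → ℂ) (hφ : DifferentiableOn ℂ φ (ball 0 1))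
    (hφ_maps : MapsTo φ (ball 0 1) (ball 0 1))
    (w₀ : HardySpace) (hw₀ : w₀ ≠ 0) (T₀ : HardySpace →L[ℂ] HardySpace)
    (hT₀ : IsWeightedComposition w₀ φ T₀) (hT₀_hs : MemSchatten 2 T₀) :
    ∃ w : HardySpace, w ≠ 0 ∧ w ≠ w₀ ∧
      ∃ T : HardySpace →L[ℂ] HardySpace, IsWeightedComposition w φ T ∧
        ∀ p : ℝ, 0 < p → p < 2 → MemSchatten p T := by
  obtain ⟨B, hB⟩ := exists_circleAverage_neg_log_le hφ hφ_maps hT₀ hw₀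
    (hT₀_hs.summable_sq_norm_apply HardySpace.monomialBasis)
  obtain ⟨v, hv, hv0, hvN⟩ := exists_weight_le_one_sub_norm_pow hφ hφ_maps hB
  have hvb : ∃ C, ∀ z ∈ ball (0 : ℂ) 1, ‖v z‖ ≤ C := by
    obtain ⟨C, hC⟩ := hvN 0
    exact ⟨C, fun z hz => by simpa using hC z hz⟩
  set w : HardySpace := HardySpace.ofBounded v hv hvb with hw
  have hwv {z : ℂ} (hz : z ∈ ball (0 : ℂ) 1) : w z = v z := HardySpace.ofBounded_apply v hv hvb hz
  have hw0 : w ≠ 0 := by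
    intro h
    refine hv0 0 ?_
    rw [← hwv (by simp), h]
    rfl
  have hscaled (c : ℂ) (N : ℕ) :
      ∃ C : ℝ, ∀ z ∈ ball (0 : ℂ) 1, ‖(c • w) z‖ ≤ C * (1 - ‖φ z‖) ^ N := by
    obtain ⟨C, hC⟩ := hvN N
    refine ⟨‖c‖ * C, fun z hz => ?_⟩
    rw [HardySpace.smul_apply, norm_mul, hwv hz, mul_assoc]
    exact mul_le_mul_of_nonneg_left (hC z hz) (norm_nonneg c)
  -- The decay bounds survive scaling, and `w` and `2 w` cannot both equal `w₀`.
  obtain ⟨c, hc0, hcw⟩ : ∃ c : ℂ, c ≠ 0 ∧ c • w ≠ w₀ := by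
    by_contra! h
    have h1 := (h 1 one_ne_zero).trans (h 2 two_ne_zero).symm
    have h2 : (1 : ℂ) = 2 := smul_left_injective ℂ hw0 h1
    norm_num at h2
  exact ⟨c • w, smul_ne_zero hc0 hw0, hcw,
    exists_isWeightedComposition_memSchatten hφ hφ_maps (c • w) (hscaled c)⟩
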